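/- \textbf{Lemma (Gradient alignment at initialization).} Let $p\ge 2$ be an integer and $\varepsilon,\sigma_w,\sigma_u>0$. For integers $k,m\ge 1$ let $d=kp$, and identify an image $x\in\mathbb{R}^d$ with the matrix $Z\in\mathbb{R}^{p\times k}$ of its $k$ non-overlapping patches $z_1,\dots,z_k\in\mathbb{R}^p$, $x=\mathrm{vec}(Z)$, $z_j=z_j(x)$. Consider the single-layer ReLU CNN with zero hidden biases $$f(x)=\sum_{i=1}^m\sum_{j=1}^k u_{ij}\max\{\langle w_i,z_j(x)\rangle,0\}+c ,$$ where $w_1,\dots,w_m\in\mathbb{R}^p$ are the columns of $W\in\mathbb{R}^{p\times m}$ and $U=(u_{ij})\in\mathbb{R}^{m\times k}$. Let the patches $z_1,\dots,z_k$ of $x$ be i.i.d. $\mathcal{U}([0,1]^p)$, let $\eta\sim\mathcal{U}([-\varepsilon,\varepsilon]^d)$, let the columns of $W$ be i.i.d. $\mathcal{N}(0,\sigma_w^2I_p)$, and let the columns of $U$ be i.i.d. $\mathcal{N}(0,\sigma_u^2I_m)$, with $x,\eta,W,U$ mutually independent. Let the loss be $\ell(x,y)=\varphi_y(f(x))$,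 where for every label $y$ the function $\varphi_y:\mathbb{R}\to\mathbb{R}$ is differentiable and $\varphi_y'$ is everywhere positive or everywhere negative (for example the logistic loss $\varphi_y(t)=\log(1+e^{-yt})$, $y\in\{\pm1\}$); the output bias $c\in\mathbb{R}$ and the label $y$ are arbitrary and may depend on $k$, $m$ and on $x,\eta,W,U$. Write $\cos(a,b)=\langle a,b\rangle/(\|a\|_2\|b\|_2)$. Then, as $k,m\to\infty$ jointly, the random variable $\cos\left(\nabla_x\ell(x,y),\nabla_x\ell(x+\eta,y)\right)$ converges in probability to a constant, and $$\lim_{k,m\to\infty}\cos\left(\nabla_x\ell(x,y),\nabla_x\ell(x+\eta,y)\right)\ \ge\ \max\left\{1-\sqrt2\;\mathbb{E}_{w,z}\left[e^{-\frac1{\varepsilon^2}\left\langle \frac{w}{\|w\|_2},z\right\rangle^2}\right]^{1/2},\ \frac12\right\},$$ where $w\sim\mathcal{N}(0,\sigma_w^2I_p)$ and $z\sim\mathcal{U}([0,1]^p)$ are independent. -/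

import Mathlib

open MeasureTheory ProbabilityTheory Filter Topology

namespace GradAlign

noncomputable section

/-- The image space `ℝ^d`, `d = k * p`. Coordinate `(j, a)` is the `a`-th entry of the `j`-th of the
`k` non-overlapping patches, each patch having `p` entries. -/
abbrev Image (p k : ℕ) : Type := EuclideanSpace ℝ (Fin k × Fin p)

/-- `x = vec(Z)`: the image whose patches are the columns `Z 0, …, Z (k - 1)`. -/
def vec {p k : ℕ} (Z : Fin k → EuclideanSpace ℝ (Fin p)) : Image p k :=
  WithLp.toLp 2 fun ja => Z ja.1 ja.2

/-- `z_j(x)`: the `j`-th patch of the image `x`. -/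
def patch {p k : ℕ} (x : Image p k) (j : Fin k) : EuclideanSpace ℝ (Fin p) :=
  WithLp.toLp 2 fun a => x (j, a)

/-- The prediction of the single-layer ReLU CNN,
`f(x) = ∑ i, ∑ j, u_{ij} * max (⟪w_i, z_j(x)⟫ + b_i) 0 + c`.
Here `W i` is the `i`-th column of the matrix `W ∈ ℝ^{p × m}` and `U j` is the `j`-th column of the
matrix `U ∈ ℝ^{m × k}`, so that `u_{ij} = U j i`. -/
def cnn {p k m : ℕ} (W : Fin m → EuclideanSpace ℝ (Fin p)) (b : Fin m → ℝ)
    (U : Fin k → EuclideanSpace ℝ (Fin m)) (c : ℝ) (x : Image p k) : ℝ :=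
  ∑ i, ∑ j, U j i * max (inner ℝ (W i) (patch x j) + b i) 0 + c

/-- The cosine of the angle between two vectors (with value `0` if one of them vanishes). -/
def cosine {E : Type*} [NormedAddCommGroup E] [InnerProductSpace ℝ E] (a b : E) : ℝ :=
  inner ℝ a b / (‖a‖ * ‖b‖)

/-- The uniform distribution on the cube `[a, b]^ι`: normalized Lebesgue measure on the cube. -/
def uniformCube (ι : Type*) [Fintype ι] (a b : ℝ) : Measure (EuclideanSpace ℝ ι) :=
  ProbabilityTheory.cond volume {v : EuclideanSpace ℝ ι | ∀ i, v i ∈ Set.Icc a b}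

/-- The isotropic Gaussian distribution `N(0, σ² I_n)`. -/
def isoGaussian (n : ℕ) (σ : ℝ) : Measure (EuclideanSpace ℝ (Fin n)) :=
  multivariateGaussian 0 (σ ^ 2 • (1 : Matrix (Fin n) (Fin n) ℝ))

/-- All the random variables `((Z, η), (W, U))`: the patches of the image, the noise, the filters
(columns of `W`) and the output weights (columns of `U`). -/
abbrev Sample (p k m : ℕ) : Type :=
  ((Fin k → EuclideanSpace ℝ (Fin p)) × Image p k) ×
    ((Fin m → EuclideanSpace ℝ (Fin p)) × (Fin k → EuclideanSpace ℝ (Fin m)))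

/-- The joint law of `((Z, η), (W, U))`, all independent: i.i.d. patches `z_j ∼ U([0,1]^p)`, noise
`η ∼ U([-ε,ε]^d)`, i.i.d. columns `w_i ∼ N(0, σw² I_p)` of `W` and i.i.d. columns
`u_j ∼ N(0, σu² I_m)` of `U`. -/
def law (p k m : ℕ) (σw σu ε : ℝ) : Measure (Sample p k m) :=
  ((Measure.pi fun _ : Fin k => uniformCube (Fin p) 0 1).prod
      (uniformCube (Fin k × Fin p) (-ε) ε)).prod
    ((Measure.pi fun _ : Fin m => isoGaussian p σw).prod
      (Measure.pi fun _ : Fin k => isoGaussian m σu))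

/-- `∇ₓ ℓ(x, y)`: the gradient with respect to the image `x` of the loss `ℓ(f(x), y)` of the CNN `f`
with filters `W`, biases `b`, output weights `U` and output bias `c`. -/
def lossGrad {p k m : ℕ} {Y : Type*} (loss : ℝ → Y → ℝ)
    (W : Fin m → EuclideanSpace ℝ (Fin p)) (b : Fin m → ℝ)
    (U : Fin k → EuclideanSpace ℝ (Fin m)) (c : ℝ) (x : Image p k) (y : Y) : Image p k :=
  gradient (fun x' => loss (cnn W b U c x') y) x

/-- `cos (∇ₓ ℓ(x, y), ∇ₓ ℓ(x + η, y))` for the sample `s = ((Z, η), (W, U))`, with `x = vec(Z)` and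
biases `b = 0`. -/
def alignment {p k m : ℕ} {Y : Type*} (loss : ℝ → Y → ℝ) (c : ℝ) (y : Y)
    (s : Sample p k m) : ℝ :=
  cosine (lossGrad loss s.2.1 0 s.2.2 c (vec s.1.1) y)
    (lossGrad loss s.2.1 0 s.2.2 c (vec s.1.1 + s.1.2) y)

end

end GradAlign

namespace GradAlign

/-! ### The uniform distribution on a cube -/

section UniformCube

variable {ι : Type*} [Fintype ι] {a b ε : ℝ}

/-! On patch `j` the input gradient of the network is the gated sum `∑ i, u_{ij} 1{⟪w_i, z_j⟫ > 0}
w_i`, and the loss multiplies it by a scalar whose sign is the same at the clean and at the noisy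
image. The cosine therefore depends on neither the loss, the label nor the output bias: it is the
ratio `⟪g, g'⟫ / (‖g‖ ‖g'‖)` of network gradients (`alignment_eq`).

After division by `k m`, each of the three inner products concentrates. Given `W`, the data of the
patches are i.i.d., and the orthogonality of the Gaussian output weights removes the cross terms, so
the conditional mean is the empirical average over the filters of `σu² ‖w‖² E[A B]`, with `A`, `B`
the two gates. Chebyshev over the patches and then over the filters gives an error of the form `C₁ /
k + C₂ / m`, so `k` and `m` may grow at unrelated rates (`prod_average_sub_ge_le`,
`tendsto_measure_average_inner_gatedSum`).

The limits are computed from the symmetry `w ↦ -w`: exactly one of `w`, `-w` is active on a generic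
patch, and one of them is active on both the clean and the noisy patch unless the noise flips the
sign of the pre-activation. Hence the cosine tends to `1 - flipMass / (p σw²)`.

Given `w` and `z`, a flip has probability at most `1/2` since the noise is symmetric, and at most
`exp (-⟪w/‖w‖, z⟫² / (2 ε²))` by Hoeffding. The first bound gives the constant `1/2`; the second,
with Cauchy–Schwarz and `E‖w‖⁴ = p (p + 2) σw⁴ ≤ 2 (p σw²)²` for `p ≥ 2`, gives the other term of
the maximum. -/

lemma isProbabilityMeasure_cond_Icc (hab : a < b) :
    IsProbabilityMeasure (cond (volume : Measure ℝ) (Set.Icc a b)) :=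
  cond_isProbabilityMeasure_of_finite (by simpa using hab) (by simp)

lemma uniformCube_eq_map_pi (hab : a < b) :
    uniformCube ι a b =
      (Measure.pi fun _ : ι => cond (volume : Measure ℝ) (Set.Icc a b)).map (WithLp.toLp 2) := by
  have := isProbabilityMeasure_cond_Icc hab
  have hset : {v : EuclideanSpace ℝ ι | ∀ i, v i ∈ Set.Icc a b} =
      WithLp.ofLp ⁻¹' (Set.univ.pi fun _ : ι => Set.Icc a b) := by
    ext v; simp [Pi.le_def, forall_and]
  have hmeas : MeasurableSet (Set.univ.pi fun _ : ι => Set.Icc a b) :=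
    MeasurableSet.univ_pi fun _ => measurableSet_Icc
  have hpi : (Measure.pi fun _ : ι => cond (volume : Measure ℝ) (Set.Icc a b)) =
      cond (volume : Measure (ι → ℝ)) (Set.univ.pi fun _ : ι => Set.Icc a b) := by
    refine Measure.pi_eq fun s hs => ?_
    rw [cond_apply hmeas, ← Set.pi_inter_distrib, volume_pi_pi, volume_pi_pi]
    simp_rw [cond_apply measurableSet_Icc]
    rw [Finset.prod_mul_distrib, ENNReal.prod_inv_distrib]
    intro i _ j _ _
    left
    simpa using hab
  rw [hpi, uniformCube, hset]
  ext t ht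
  rw [Measure.map_apply (by fun_prop) ht, cond_apply hmeas,
    cond_apply (hmeas.preimage (by fun_prop)),
    (PiLp.volume_preserving_ofLp ι).measure_preimage hmeas.nullMeasurableSet,
    ← (PiLp.volume_preserving_toLp ι).measure_preimage
      ((hmeas.preimage (by fun_prop)).inter ht).nullMeasurableSet]
  rfl

lemma isProbabilityMeasure_uniformCube (hab : a < b) :
    IsProbabilityMeasure (uniformCube ι a b) := by
  have := isProbabilityMeasure_cond_Icc hab
  rw [uniformCube_eq_map_pi hab]
  exact Measure.isProbabilityMeasure_map (by fun_prop)

lemma uniformCube_absolutelyContinuous : uniformCube ι a b ≪ volume :=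
  cond_absolutelyContinuous

lemma measurePreserving_neg_uniformCube :
    MeasurePreserving (fun v : EuclideanSpace ℝ ι => -v) (uniformCube ι (-ε) ε)
      (uniformCube ι (-ε) ε) := by
  have hmeas : MeasurableSet {v : EuclideanSpace ℝ ι | ∀ i, v i ∈ Set.Icc (-ε) ε} := by
    rw [Set.ofPred_forall]
    exact MeasurableSet.iInter fun i => measurableSet_Icc.preimage (by fun_prop)
  refine ⟨measurable_neg, ?_⟩
  ext t ht
  rw [Measure.map_apply measurable_neg ht, uniformCube, cond_apply hmeas, cond_apply hmeas]
  congr 1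
  rw [← Measure.measure_neg]
  congr 1
  ext v
  simp only [Set.mem_neg, Set.mem_inter_iff, Set.mem_ofPred_eq, Set.mem_preimage, neg_neg,
    Set.mem_Icc, PiLp.neg_apply]
  refine and_congr_left fun _ => forall_congr' fun i => ?_
  constructor <;> rintro ⟨h1, h2⟩ <;> constructor <;> linarith

/-- A uniform image consists of independent uniform patches. -/
lemma measurePreserving_patch {p k : ℕ} (hab : a < b) :
    MeasurePreserving (fun (x : Image p k) (j : Fin k) => patch x j)
      (uniformCube (Fin k × Fin p) a b) (Measure.pi fun _ => uniformCube (Fin p) a b) := by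
  have := isProbabilityMeasure_cond_Icc hab
  have hm : Measurable (fun (x : Image p k) (j : Fin k) => patch x j) := by
    unfold patch
    fun_prop
  refine ⟨hm, ?_⟩
  simp_rw [uniformCube_eq_map_pi hab]
  have h := Measure.infinitePi_map_curry
    (fun (_ : Fin k) (_ : Fin p) => cond (volume : Measure ℝ) (Set.Icc a b))
  simp_rw [Measure.infinitePi_eq_pi] at h
  have hpi := Measure.pi_map_pi
    (μ := fun _ : Fin k => Measure.pi fun _ : Fin p => cond (volume : Measure ℝ) (Set.Icc a b))
    (f := fun _ => WithLp.toLp 2)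
    (hμ := fun _ => by
      rw [← uniformCube_eq_map_pi hab]
      have := isProbabilityMeasure_uniformCube (ι := Fin p) hab
      infer_instance) (by fun_prop)
  rw [← hpi, ← h, Measure.map_map hm (by fun_prop), Measure.map_map (by fun_prop) (by fun_prop)]
  rfl

/-- Hoeffding's inequality for a linear functional of a uniform vector. -/
lemma uniformCube_real_le_inner (hε : 0 < ε) (w : EuclideanSpace ℝ ι) {t : ℝ} (ht : 0 ≤ t) :
    (uniformCube ι (-ε) ε).real {v | t ≤ inner ℝ w v} ≤
      Real.exp (-t ^ 2 / (2 * (ε ^ 2 * ‖w‖ ^ 2))) := by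
  have hab : -ε < ε := by linarith
  have := isProbabilityMeasure_cond_Icc hab
  set ν := cond (volume : Measure ℝ) (Set.Icc (-ε) ε) with hν
  have hIcc : ∀ᵐ x ∂ν, id x ∈ Set.Icc (-ε) ε := ae_cond_mem measurableSet_Icc
  have hzero : ∫ x, id x ∂ν = 0 := by
    rw [hν, ProbabilityTheory.cond, integral_smul_measure,
      integral_Icc_eq_integral_Ioc,
      ← intervalIntegral.integral_of_le hab.le]
    simp
  -- Hoeffding's lemma: each coordinate is sub-Gaussian with variance proxy `ε²`, the squared
  -- half-width of the interval, so the weighted independent sum has proxy `ε² ‖w‖²`.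
  have hsub := hasSubgaussianMGF_of_mem_Icc_of_integral_eq_zero (μ := ν) aemeasurable_id hIcc hzero
  have hind : iIndepFun (fun (i : ι) (v : ι → ℝ) => w i * v i) (Measure.pi fun _ : ι => ν) :=
    iIndepFun_pi (X := fun i x => w i * x) (fun i => by fun_prop)
  have hsum := HasSubgaussianMGF.sum_of_iIndepFun hind (s := Finset.univ) (fun i _ => by
    have h1 : HasSubgaussianMGF (fun v : ι → ℝ => v i) ((‖ε - -ε‖₊ / 2) ^ 2)
        (Measure.pi fun _ : ι => ν) := by
      refine HasSubgaussianMGF.of_map (Y := fun v : ι → ℝ => v i) (X := id)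
        (measurable_pi_apply i).aemeasurable ?_
      rw [(measurePreserving_eval (fun _ : ι => ν) i).map_eq]
      exact hsub
    exact h1.const_mul (w i))
  have h := hsum.measure_ge_le ht
  rw [uniformCube_eq_map_pi hab, map_measureReal_apply (by fun_prop)
    (measurableSet_le (by fun_prop) (by fun_prop))]
  convert h using 1
  · congr 1
    ext v
    simp [PiLp.inner_apply, mul_comm]
  · congr 2
    rw [EuclideanSpace.real_norm_sq_eq]
    have hc : ((‖ε - -ε‖₊ / 2) ^ 2 : NNReal) = ε ^ 2 := by
      push_cast
      rw [sub_neg_eq_add, ← two_mul, Real.norm_of_nonneg (by positivity)]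
      ring
    simp only [NNReal.coe_sum, Finset.mul_sum]
    refine Finset.sum_congr rfl fun i _ => ?_
    rw [← hc, mul_comm (NNReal.toReal _)]
    rfl

end UniformCube

/-! ### The isotropic Gaussian distribution -/

section IsoGaussian

lemma integral_pow_four_gaussianReal (v : NNReal) :
    ∫ x, x ^ 4 ∂(gaussianReal 0 v) = 3 * (v : ℝ) ^ 2 := by
  have h := iteratedDeriv_mgf_zero (X := fun x : ℝ => x) (μ := gaussianReal 0 v) (by simp) 4
  simp only [Pi.pow_apply] at h
  rw [← h, mgf_fun_id_gaussianReal]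
  simp only [zero_mul, zero_add]
  -- Differentiating `P · exp (v t² / 2)` replaces the polynomial `P` by `P' + v t P`; four rounds
  -- starting from `1` leave the constant term `3 v²`.
  have key : ∀ P Q : ℝ → ℝ, (∀ t, HasDerivAt P (Q t - v * t * P t) t) →
      deriv (fun t => P t * Real.exp (v * t ^ 2 / 2)) =
        fun t => Q t * Real.exp (v * t ^ 2 / 2) := by
    intro P Q hP
    ext t
    have he : HasDerivAt (fun t : ℝ => Real.exp (v * t ^ 2 / 2))
        (Real.exp (v * t ^ 2 / 2) * (v * t)) t := by
      refine HasDerivAt.exp ?_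
      convert! (((hasDerivAt_id t).pow 2).const_mul (v : ℝ)).div_const 2 using 1
      simp
      ring
    rw [HasDerivAt.deriv ((hP t).fun_mul he)]
    ring
  have h0 : (fun t : ℝ => Real.exp (v * t ^ 2 / 2)) =
      fun t : ℝ => (1 : ℝ) * Real.exp (v * t ^ 2 / 2) := by simp
  rw [iteratedDeriv_eq_iterate]
  simp only [Function.iterate_succ, Function.iterate_zero, Function.comp, id]
  rw [h0, key (fun _ => 1) (fun t => v * t), key _ (fun t => v + v ^ 2 * t ^ 2),
    key _ (fun t => 3 * v ^ 2 * t + v ^ 3 * t ^ 3),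
    key _ (fun t => 3 * v ^ 2 + 6 * v ^ 3 * t ^ 2 + v ^ 4 * t ^ 4)]
  · simp
  · intro t
    convert! ((hasDerivAt_id t).const_mul (3 * (v : ℝ) ^ 2)).add
      (((hasDerivAt_id t).pow 3).const_mul ((v : ℝ) ^ 3)) using 1
    simp
    ring
  · intro t
    convert! (((hasDerivAt_id t).pow 2).const_mul ((v : ℝ) ^ 2)).const_add (v : ℝ) using 1
    simp
    ring
  · intro t
    convert! (hasDerivAt_id t).const_mul (v : ℝ) using 1
    simp
    ring
  · intro t
    convert! hasDerivAt_const t (1 : ℝ) using 1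
    ring

variable {n : ℕ} {σ : ℝ}

instance isGaussian_isoGaussian : IsGaussian (isoGaussian n σ) := by
  unfold isoGaussian; infer_instance

lemma posSemidef_sq_smul_one : (σ ^ 2 • (1 : Matrix (Fin n) (Fin n) ℝ)).PosSemidef :=
  Matrix.PosSemidef.one.smul (sq_nonneg σ)

lemma integral_id_isoGaussian : ∫ u, u ∂(isoGaussian n σ) = 0 :=
  integral_id_multivariateGaussian

lemma integral_inner_mul_inner_isoGaussian (v w : EuclideanSpace ℝ (Fin n)) :
    ∫ u, inner ℝ v u * inner ℝ w u ∂(isoGaussian n σ) = σ ^ 2 * inner ℝ v w := by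
  have h := covarianceBilin_multivariateGaussian (μ := 0)
    (posSemidef_sq_smul_one (n := n) (σ := σ)) v w
  rw [covarianceBilin_apply (IsGaussian.memLp_id _ _ (by simp))] at h
  have h0 : ∫ u, id u ∂(multivariateGaussian 0 (σ ^ 2 • (1 : Matrix (Fin n) (Fin n) ℝ))) = 0 :=
    integral_id_multivariateGaussian
  simp only [h0, sub_zero] at h
  rw [isoGaussian, h, Matrix.smul_mulVec, Matrix.one_mulVec, dotProduct_smul, real_inner_comm]
  rfl

/-- Linear functionals of an isotropic Gaussian vector are Gaussian. -/
lemma map_inner_isoGaussian (v : EuclideanSpace ℝ (Fin n)) :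
    (isoGaussian n σ).map (fun u => inner ℝ v u) = gaussianReal 0 (σ ^ 2 * ‖v‖ ^ 2).toNNReal := by
  have h := IsGaussian.map_eq_gaussianReal (μ := isoGaussian n σ) (innerSL ℝ v)
  have h0 : ∫ u, (innerSL ℝ v) u ∂(isoGaussian n σ) = 0 := by
    rw [ContinuousLinearMap.integral_comp_comm _ IsGaussian.integrable_fun_id,
      integral_id_isoGaussian]
    simp
  have hv : Var[innerSL ℝ v; isoGaussian n σ] = σ ^ 2 * ‖v‖ ^ 2 := by
    rw [variance_of_integral_eq_zero (by fun_prop) h0, ← real_inner_self_eq_norm_sq,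
      ← integral_inner_mul_inner_isoGaussian]
    simp [sq]
  rw [h0, hv] at h
  exact h

lemma integral_inner_pow_four_isoGaussian (v : EuclideanSpace ℝ (Fin n)) :
    ∫ u, inner ℝ v u ^ 4 ∂(isoGaussian n σ) = 3 * σ ^ 4 * ‖v‖ ^ 4 := by
  rw [← integral_map (φ := fun u => inner ℝ v u) (f := fun x => x ^ 4) (by fun_prop) (by fun_prop),
    map_inner_isoGaussian, integral_pow_four_gaussianReal, Real.coe_toNNReal _ (by positivity)]
  ring

lemma memLp_inner_isoGaussian (v : EuclideanSpace ℝ (Fin n)) {q : ENNReal} (hq : q ≠ ⊤) :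
    MemLp (fun u => inner ℝ v u) q (isoGaussian n σ) :=
  (IsGaussian.memLp_id (isoGaussian n σ) q hq).continuousLinearMap_comp (innerSL ℝ v)

lemma measurePreserving_neg_isoGaussian :
    MeasurePreserving (fun u => -u) (isoGaussian n σ) (isoGaussian n σ) := by
  refine ⟨measurable_neg, ?_⟩
  have : IsFiniteMeasure ((isoGaussian n σ).map fun u => -u) := by infer_instance
  apply Measure.ext_of_charFun
  ext t
  rw [charFun_apply, integral_map (by fun_prop) (by fun_prop)]
  have : ∀ x : EuclideanSpace ℝ (Fin n), inner ℝ (-x) t = inner ℝ x (-t) := by simp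
  simp_rw [this]
  rw [← charFun_apply, isoGaussian, charFun_multivariateGaussian posSemidef_sq_smul_one,
    charFun_multivariateGaussian posSemidef_sq_smul_one]
  simp [Matrix.mulVec_neg]

/-- A nonzero linear functional of an isotropic Gaussian vector is almost surely nonzero. -/
lemma ae_inner_ne_zero_isoGaussian (hσ : 0 < σ) {v : EuclideanSpace ℝ (Fin n)} (hv : v ≠ 0) :
    ∀ᵐ u ∂(isoGaussian n σ), inner ℝ u v ≠ 0 := by
  have hne : (σ ^ 2 * ‖v‖ ^ 2).toNNReal ≠ 0 := by
    have := norm_pos_iff.2 hv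
    rw [ne_eq, Real.toNNReal_eq_zero, not_le]
    positivity
  have := nullSingletonClass_gaussianReal (μ := 0) hne
  have h : ∀ᵐ x ∂((isoGaussian n σ).map fun u => inner ℝ v u), x ≠ 0 := by
    rw [map_inner_isoGaussian]
    exact compl_mem_ae_iff.2 (measure_singleton 0)
  filter_upwards [ae_of_ae_map (by fun_prop) h] with u hu
  rwa [real_inner_comm]

lemma integrable_norm_pow_isoGaussian (q : ℕ) :
    Integrable (fun w => ‖w‖ ^ q) (isoGaussian n σ) :=
  (IsGaussian.memLp_id (isoGaussian n σ) q (by simp)).integrable_norm_pow'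

lemma inner_basis (a : Fin n) (w : EuclideanSpace ℝ (Fin n)) :
    inner ℝ (EuclideanSpace.single a (1 : ℝ)) w = w a := by
  simp [EuclideanSpace.inner_single_left]

lemma integral_norm_sq_isoGaussian :
    ∫ w, ‖w‖ ^ 2 ∂(isoGaussian n σ) = n * σ ^ 2 := by
  simp_rw [EuclideanSpace.real_norm_sq_eq]
  rw [integral_finsetSum]
  · have h : ∀ a : Fin n, ∫ w : EuclideanSpace ℝ (Fin n), w a ^ 2 ∂(isoGaussian n σ) = σ ^ 2 := by
      intro a
      have := integral_inner_mul_inner_isoGaussian (σ := σ) (EuclideanSpace.single a (1 : ℝ))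
        (EuclideanSpace.single a (1 : ℝ))
      simpa [sq, inner_basis] using this
    simp [h]
  · intro a _
    have := (memLp_inner_isoGaussian (σ := σ) (EuclideanSpace.single a (1 : ℝ))
      (q := 2) (by simp)).integrable_sq
    simpa [inner_basis] using this

lemma integral_sq_mul_sq_isoGaussian {a b : Fin n} (hab : a ≠ b) :
    ∫ w : EuclideanSpace ℝ (Fin n), w a ^ 2 * w b ^ 2 ∂(isoGaussian n σ) = σ ^ 4 := by
  set ea := EuclideanSpace.single a (1 : ℝ) with hea
  set eb := EuclideanSpace.single b (1 : ℝ) with heb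
  have hi : ∀ v : EuclideanSpace ℝ (Fin n),
      Integrable (fun u => inner ℝ v u ^ 4) (isoGaussian n σ) := fun v => by
    have := (memLp_inner_isoGaussian (σ := σ) v (q := 4) (by simp)).integrable_norm_pow'
    refine this.congr (ae_of_all _ fun u => ?_)
    simp only [Real.norm_eq_abs]
    exact Even.pow_abs (by decide) _
  -- Polarization reduces the mixed moment to fourth moments of linear functionals, so only
  -- one-dimensional marginals are needed.
  have hid : ∀ w : EuclideanSpace ℝ (Fin n), w a ^ 2 * w b ^ 2 =
      12⁻¹ * (inner ℝ (ea + eb) w ^ 4 + inner ℝ (ea - eb) w ^ 4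
        - 2 * inner ℝ ea w ^ 4 - 2 * inner ℝ eb w ^ 4) := by
    intro w
    rw [inner_add_left, inner_sub_left, hea, heb, inner_basis, inner_basis]
    ring
  have hna : ‖ea‖ = 1 := by simp [hea]
  have hnb : ‖eb‖ = 1 := by simp [heb]
  have hin : inner ℝ ea eb = (0 : ℝ) := by
    rw [hea, inner_basis]
    simp [heb, hab]
  have hp : ‖ea + eb‖ ^ 2 = 2 := by rw [norm_add_sq_real, hna, hnb, hin]; norm_num
  have hm : ‖ea - eb‖ ^ 2 = 2 := by rw [norm_sub_sq_real, hna, hnb, hin]; norm_num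
  simp_rw [hid]
  rw [integral_const_mul, integral_sub, integral_sub, integral_add (hi _) (hi _),
    integral_const_mul, integral_const_mul]
  · simp_rw [integral_inner_pow_four_isoGaussian]
    rw [hna, hnb, show ‖ea + eb‖ ^ 4 = (‖ea + eb‖ ^ 2) ^ 2 by ring,
      show ‖ea - eb‖ ^ 4 = (‖ea - eb‖ ^ 2) ^ 2 by ring, hp, hm]
    ring
  · exact (hi _).add (hi _)
  · exact (hi _).const_mul _
  · exact ((hi _).add (hi _)).sub ((hi _).const_mul _)
  · exact (hi _).const_mul _

lemma integral_norm_pow_four_isoGaussian :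
    ∫ w, ‖w‖ ^ 4 ∂(isoGaussian n σ) = n * (n + 2) * σ ^ 4 := by
  have hw : ∀ w : EuclideanSpace ℝ (Fin n), ‖w‖ ^ 4 = ∑ a, ∑ b, w a ^ 2 * w b ^ 2 := by
    intro w
    rw [show ‖w‖ ^ 4 = (‖w‖ ^ 2) ^ 2 by ring, EuclideanSpace.real_norm_sq_eq, sq,
      Finset.sum_mul_sum]
  have hint : ∀ a b : Fin n, Integrable (fun w : EuclideanSpace ℝ (Fin n) => w a ^ 2 * w b ^ 2)
      (isoGaussian n σ) := by
    intro a b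
    refine (integrable_norm_pow_isoGaussian 4).mono' (by fun_prop) (ae_of_all _ fun w => ?_)
    rw [Real.norm_of_nonneg (by positivity), show ‖w‖ ^ 4 = ‖w‖ ^ 2 * ‖w‖ ^ 2 by ring]
    have h : ∀ a, w a ^ 2 ≤ ‖w‖ ^ 2 := fun a => by
      rw [EuclideanSpace.real_norm_sq_eq]
      exact Finset.single_le_sum (f := fun i => w i ^ 2) (fun _ _ => sq_nonneg _)
        (Finset.mem_univ a)
    exact mul_le_mul (h a) (h b) (sq_nonneg _) (sq_nonneg _)
  have hval : ∀ a b : Fin n,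
      ∫ w : EuclideanSpace ℝ (Fin n), w a ^ 2 * w b ^ 2 ∂(isoGaussian n σ) =
        σ ^ 4 + if a = b then 2 * σ ^ 4 else 0 := by
    intro a b
    split_ifs with hab
    · subst hab
      have := integral_inner_pow_four_isoGaussian (σ := σ) (EuclideanSpace.single a (1 : ℝ))
      simp only [inner_basis] at this
      simp_rw [← pow_add]
      rw [this]
      simp
      ring
    · rw [integral_sq_mul_sq_isoGaussian hab, add_zero]
  simp_rw [hw]
  rw [integral_finsetSum _ fun a _ => integrable_finsetSum _ fun b _ => hint a b]
  simp_rw [integral_finsetSum _ fun b _ => hint _ b, hval, Finset.sum_add_distrib]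
  simp
  ring

end IsoGaussian

/-! ### A two-stage weak law of large numbers -/

section WeakLaw

variable {Ω E V : Type*} [MeasurableSpace Ω] [MeasurableSpace E] [MeasurableSpace V]

/-- Chebyshev, with the second moment in place of the variance: it is this quantity that is later
bounded by an empirical average over `W` and then integrated. -/
lemma pi_average_sub_integral_ge_le {ν : Measure Ω} [IsProbabilityMeasure ν] {f : Ω → ℝ}
    (hf : MemLp f 2 ν) {k : ℕ} (hk : 0 < k) {δ : ℝ} (hδ : 0 < δ) :
    (Measure.pi fun _ : Fin k => ν) {v | δ ≤ |(k : ℝ)⁻¹ * ∑ j, f (v j) - ∫ x, f x ∂ν|} ≤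
      ENNReal.ofReal ((∫ x, f x ^ 2 ∂ν) / (k * δ ^ 2)) := by
  have hk' : (0 : ℝ) < k := by exact_mod_cast hk
  have hj : ∀ j : Fin k, MemLp (fun v : Fin k → Ω => f (v j)) 2 (Measure.pi fun _ => ν) :=
    fun j => hf.comp_measurePreserving (measurePreserving_eval (fun _ : Fin k => ν) j)
  have hsum : MemLp (fun v : Fin k → Ω => ∑ j, f (v j)) 2 (Measure.pi fun _ => ν) :=
    memLp_finsetSum _ fun j _ => hj j
  have hmean : ∫ v, (k : ℝ)⁻¹ * ∑ j, f (v j) ∂(Measure.pi fun _ : Fin k => ν) = ∫ x, f x ∂ν := by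
    rw [integral_const_mul, integral_finsetSum _ fun j _ => (hj j).integrable (by norm_num)]
    have : ∀ j : Fin k, ∫ v, f (v j) ∂(Measure.pi fun _ : Fin k => ν) = ∫ x, f x ∂ν := fun j =>
      integral_comp_eval hf.aestronglyMeasurable
    simp [this]
    field_simp
  have hvar : Var[fun v => (k : ℝ)⁻¹ * ∑ j, f (v j); Measure.pi fun _ : Fin k => ν] ≤
      (∫ x, f x ^ 2 ∂ν) / k := by
    have h := variance_sum_pi (μ := fun _ : Fin k => ν) (X := fun _ => f) fun _ => hf
    have h' : (∑ j : Fin k, fun v : Fin k → Ω => f (v j)) = fun v => ∑ j, f (v j) := by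
      ext v; simp
    rw [h'] at h
    rw [variance_const_mul, h]
    have hle : Var[f; ν] ≤ ∫ x, f x ^ 2 ∂ν := variance_le_expectation_sq hf.aestronglyMeasurable
    simp only [Finset.sum_const, Finset.card_univ, Fintype.card_fin, nsmul_eq_mul]
    calc (k : ℝ)⁻¹ ^ 2 * (k * Var[f; ν]) = Var[f; ν] / k := by field_simp
      _ ≤ _ := by gcongr
  have h := meas_ge_le_variance_div_sq (hsum.const_mul (k : ℝ)⁻¹) hδ
  rw [hmean] at h
  refine h.trans (ENNReal.ofReal_le_ofReal ?_)
  rw [← div_div]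
  gcongr

lemma integral_pi_average {γ : Measure E} [IsProbabilityMeasure γ] {G : E → ℝ}
    (hG : Integrable G γ) {m : ℕ} (hm : 0 < m) :
    Integrable (fun W : Fin m → E => (m : ℝ)⁻¹ * ∑ i, G (W i)) (Measure.pi fun _ => γ) ∧
    ∫ W, (m : ℝ)⁻¹ * ∑ i, G (W i) ∂(Measure.pi fun _ : Fin m => γ) = ∫ w, G w ∂γ := by
  have hm' : (0 : ℝ) < m := by exact_mod_cast hm
  have hi : ∀ i : Fin m, Integrable (fun W : Fin m → E => G (W i)) (Measure.pi fun _ => γ) :=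
    fun i => (measurePreserving_eval (fun _ : Fin m => γ) i).integrable_comp_of_integrable hG
  refine ⟨(integrable_finsetSum _ fun i _ => hi i).const_mul _, ?_⟩
  rw [integral_const_mul, integral_finsetSum _ fun i _ => hi i]
  have : ∀ i : Fin m, ∫ W, G (W i) ∂(Measure.pi fun _ : Fin m => γ) = ∫ w, G w ∂γ := fun i =>
    integral_comp_eval hG.aestronglyMeasurable
  simp [this]
  field_simp

/-- If the conditional mean and the conditional second moment of `Y W` are empirical averages over
the sample `W`, then the average of `Y W` over a second sample is close to its mean. -/
lemma prod_average_sub_ge_le {γ : Measure E} [IsProbabilityMeasure γ] {ρ : Measure V}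
    [IsProbabilityMeasure ρ] {k m : ℕ} (hk : 0 < k) (hm : 0 < m) {Y : (Fin m → E) → V → ℝ}
    (hY : Measurable (Function.uncurry Y)) (hY2 : ∀ W, MemLp (Y W) 2 ρ)
    {G h : E → ℝ} (hG : Integrable G γ) (hG0 : ∀ w, 0 ≤ G w)
    (hYG : ∀ W, ∫ v, Y W v ^ 2 ∂ρ ≤ (m : ℝ)⁻¹ * ∑ i, G (W i))
    (hh : Measurable h) (hh2 : MemLp h 2 γ)
    (hYh : ∀ W, ∫ v, Y W v ∂ρ = (m : ℝ)⁻¹ * ∑ i, h (W i)) {δ : ℝ} (hδ : 0 < δ) :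
    ((Measure.pi fun _ : Fin m => γ).prod (Measure.pi fun _ : Fin k => ρ))
        {ω | δ ≤ |(k : ℝ)⁻¹ * ∑ j, Y ω.1 (ω.2 j) - ∫ w, h w ∂γ|} ≤
      ENNReal.ofReal ((∫ w, G w ∂γ) / (k * (δ / 2) ^ 2)) +
        ENNReal.ofReal ((∫ w, h w ^ 2 ∂γ) / (m * (δ / 2) ^ 2)) := by
  have hδ2 : 0 < δ / 2 := by positivity
  set S₁ : Set ((Fin m → E) × (Fin k → V)) :=
    {ω | δ / 2 ≤ |(k : ℝ)⁻¹ * ∑ j, Y ω.1 (ω.2 j) - (m : ℝ)⁻¹ * ∑ i, h (ω.1 i)|} with hS₁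
  set S₂ : Set (Fin m → E) := {W | δ / 2 ≤ |(m : ℝ)⁻¹ * ∑ i, h (W i) - ∫ w, h w ∂γ|} with hS₂
  -- The deviation splits at the conditional mean given `W`: either the average over the second
  -- sample is off by `δ / 2`, or the conditional mean is.
  have hsub : {ω : (Fin m → E) × (Fin k → V) |
      δ ≤ |(k : ℝ)⁻¹ * ∑ j, Y ω.1 (ω.2 j) - ∫ w, h w ∂γ|} ⊆ S₁ ∪ (S₂ ×ˢ Set.univ) := by
    intro ω hω
    by_contra hcon
    simp only [hS₁, hS₂, Set.mem_union, Set.mem_prod, Set.mem_univ, and_true, not_or,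
      Set.mem_ofPred_eq, not_le] at hcon hω
    have := abs_sub_le ((k : ℝ)⁻¹ * ∑ j, Y ω.1 (ω.2 j)) ((m : ℝ)⁻¹ * ∑ i, h (ω.1 i))
      (∫ w, h w ∂γ)
    linarith [hcon.1, hcon.2]
  refine (measure_mono hsub).trans ((measure_union_le _ _).trans (add_le_add ?_ ?_))
  · have hmeas : MeasurableSet S₁ := by
      refine measurableSet_le measurable_const (Measurable.abs (Measurable.sub ?_ ?_))
      · refine Measurable.const_mul (Finset.measurable_sum _ fun j _ => ?_) _
        have hω : Measurable fun ω : (Fin m → E) × (Fin k → V) => (ω.1, ω.2 j) := by fun_prop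
        exact hY.comp hω
      · fun_prop
    rw [Measure.prod_apply hmeas]
    obtain ⟨hi, he⟩ := integral_pi_average hG hm
    -- Fubini: Chebyshev for fixed `W`, then integration over `W`. Averaging `G` makes the resulting
    -- bound free of `m`.
    calc ∫⁻ W, (Measure.pi fun _ : Fin k => ρ) (Prod.mk W ⁻¹' S₁) ∂(Measure.pi fun _ : Fin m => γ)
        ≤ ∫⁻ W, ENNReal.ofReal (((m : ℝ)⁻¹ * ∑ i, G (W i)) / (k * (δ / 2) ^ 2))
            ∂(Measure.pi fun _ : Fin m => γ) := by
          refine lintegral_mono fun W => ?_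
          have h1 := pi_average_sub_integral_ge_le (hY2 W) hk hδ2
          rw [hYh W] at h1
          exact h1.trans (ENNReal.ofReal_le_ofReal (by gcongr; exact hYG W))
      _ = ENNReal.ofReal ((∫ w, G w ∂γ) / (k * (δ / 2) ^ 2)) := by
          rw [← ofReal_integral_eq_lintegral_ofReal (hi.div_const _)
            (ae_of_all _ fun W => by
              have := Finset.sum_nonneg fun i (_ : i ∈ Finset.univ) => hG0 (W i)
              positivity),
            integral_div, he]
  · rw [Measure.prod_prod, measure_univ, mul_one]
    exact pi_average_sub_integral_ge_le hh2 hm hδ2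

end WeakLaw

/-! ### Random features with Gaussian output weights -/

section RandomFeatures

variable {p m : ℕ} {Ξ : Type*} [MeasurableSpace Ξ]

/-- The sum of the filters `W i`, gated by `A (W i) ξ` and weighted by `u i`. -/
noncomputable def gatedSum (A : EuclideanSpace ℝ (Fin p) → Ξ → ℝ)
    (W : Fin m → EuclideanSpace ℝ (Fin p)) (v : Ξ × EuclideanSpace ℝ (Fin m)) :
    EuclideanSpace ℝ (Fin p) :=
  ∑ i, (v.2 i * A (W i) v.1) • W i

variable {A B : EuclideanSpace ℝ (Fin p) → Ξ → ℝ} {σ : ℝ}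

lemma measurable_gatedSum (hA : Measurable (Function.uncurry A)) :
    Measurable fun q : (Fin m → EuclideanSpace ℝ (Fin p)) × (Ξ × EuclideanSpace ℝ (Fin m)) =>
      gatedSum A q.1 q.2 := by
  unfold gatedSum
  refine Finset.measurable_sum _ fun i _ => ?_
  have hq : Measurable fun q : (Fin m → EuclideanSpace ℝ (Fin p)) ×
      (Ξ × EuclideanSpace ℝ (Fin m)) => (q.1 i, q.2.1) := by fun_prop
  have hAq : Measurable fun q : (Fin m → EuclideanSpace ℝ (Fin p)) ×
      (Ξ × EuclideanSpace ℝ (Fin m)) => A (q.1 i) q.2.1 := hA.comp hq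
  fun_prop

-- A crude bound that serves only for integrability; it is too weak in `m` for the limit theorem.
omit [MeasurableSpace Ξ] in
lemma norm_gatedSum_le (hA1 : ∀ w ξ, |A w ξ| ≤ 1) (W : Fin m → EuclideanSpace ℝ (Fin p))
    (v : Ξ × EuclideanSpace ℝ (Fin m)) : ‖gatedSum A W v‖ ≤ ‖v.2‖ * ∑ i, ‖W i‖ := by
  rw [gatedSum, Finset.mul_sum]
  refine (norm_sum_le _ _).trans (Finset.sum_le_sum fun i _ => ?_)
  rw [norm_smul, norm_mul]
  gcongr
  calc ‖v.2 i‖ * ‖A (W i) v.1‖ ≤ ‖v.2‖ * 1 := by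
        gcongr
        · exact PiLp.norm_apply_le v.2 i
        · exact hA1 _ _
    _ = ‖v.2‖ := mul_one _

-- For fixed gates every coordinate of the gated sum is a linear functional of the Gaussian `u`,
-- with fourth moment `3 σ⁴ ‖c a‖⁴`. One factor `p` comes from Cauchy–Schwarz over the coordinates,
-- the other from summing over them.
omit [MeasurableSpace Ξ] in
lemma integral_norm_gatedSum_pow_four_le (hA1 : ∀ w ξ, |A w ξ| ≤ 1)
    (W : Fin m → EuclideanSpace ℝ (Fin p)) (ξ : Ξ) :
    ∫ u, ‖gatedSum A W (ξ, u)‖ ^ 4 ∂(isoGaussian m σ) ≤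
      3 * p ^ 2 * σ ^ 4 * (∑ i, ‖W i‖ ^ 2) ^ 2 := by
  set c : Fin p → EuclideanSpace ℝ (Fin m) :=
    fun a => WithLp.toLp 2 fun i => A (W i) ξ * W i a with hc
  have hcoord : ∀ u a, gatedSum A W (ξ, u) a = inner ℝ (c a) u := by
    intro u a
    simp only [gatedSum, hc, PiLp.inner_apply, WithLp.ofLp_sum, Finset.sum_apply, PiLp.smul_apply,
      smul_eq_mul, RCLike.inner_apply, conj_trivial]
    exact Finset.sum_congr rfl fun i _ => by ring
  have hnorm : ∀ a, ‖c a‖ ^ 2 ≤ ∑ i, ‖W i‖ ^ 2 := by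
    intro a
    rw [EuclideanSpace.real_norm_sq_eq]
    refine Finset.sum_le_sum fun i _ => ?_
    have h1 : A (W i) ξ ^ 2 ≤ 1 := (sq_le_one_iff_abs_le_one _).2 (hA1 _ _)
    have h2 : W i a ^ 2 ≤ ‖W i‖ ^ 2 := by
      rw [← sq_abs]
      gcongr
      exact PiLp.norm_apply_le (W i) a
    calc (A (W i) ξ * W i a) ^ 2 = A (W i) ξ ^ 2 * W i a ^ 2 := by ring
      _ ≤ 1 * ‖W i‖ ^ 2 := by gcongr
      _ = _ := one_mul _
  have hint : ∀ a, Integrable (fun u => inner ℝ (c a) u ^ 4) (isoGaussian m σ) := fun a => by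
    refine (memLp_inner_isoGaussian (σ := σ) (c a) (q := 4) (by simp)).integrable_norm_pow'.congr
      (ae_of_all _ fun u => ?_)
    exact Even.pow_abs (by decide) _
  calc ∫ u, ‖gatedSum A W (ξ, u)‖ ^ 4 ∂(isoGaussian m σ)
      ≤ ∫ u, p * ∑ a, inner ℝ (c a) u ^ 4 ∂(isoGaussian m σ) := by
        refine integral_mono_of_nonneg (ae_of_all _ fun u => by positivity)
          ((integrable_finsetSum _ fun a _ => hint a).const_mul _) (ae_of_all _ fun u => ?_)
        simp only
        rw [show ‖gatedSum A W (ξ, u)‖ ^ 4 = (‖gatedSum A W (ξ, u)‖ ^ 2) ^ 2 by ring,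
          EuclideanSpace.real_norm_sq_eq]
        refine (sq_sum_le_card_mul_sum_sq).trans ?_
        simp_rw [hcoord, ← pow_mul]
        simp
    _ = p * ∑ a, 3 * σ ^ 4 * (‖c a‖ ^ 2) ^ 2 := by
        rw [integral_const_mul, integral_finsetSum _ fun a _ => hint a]
        simp_rw [integral_inner_pow_four_isoGaussian, ← pow_mul]
    _ ≤ p * ∑ a : Fin p, 3 * σ ^ 4 * (∑ i, ‖W i‖ ^ 2) ^ 2 := by
        gcongr with a
        exact hnorm a
    _ = _ := by simp; ring

-- The output weights are uncorrelated with variance `σ²`, so only the diagonal of the double sum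
-- over filters survives.
omit [MeasurableSpace Ξ] in
lemma integral_inner_gatedSum (W : Fin m → EuclideanSpace ℝ (Fin p)) (ξ : Ξ) :
    ∫ u, inner ℝ (gatedSum A W (ξ, u)) (gatedSum B W (ξ, u)) ∂(isoGaussian m σ) =
      ∑ i, σ ^ 2 * ‖W i‖ ^ 2 * (A (W i) ξ * B (W i) ξ) := by
  have hexp : ∀ u, inner ℝ (gatedSum A W (ξ, u)) (gatedSum B W (ξ, u)) =
      ∑ i, ∑ i', (inner ℝ (EuclideanSpace.single i (1 : ℝ)) u *
        inner ℝ (EuclideanSpace.single i' (1 : ℝ)) u) *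
          (A (W i) ξ * B (W i') ξ * inner ℝ (W i) (W i')) := by
    intro u
    simp only [gatedSum, sum_inner, inner_sum, real_inner_smul_left, real_inner_smul_right,
      inner_basis]
    rw [Finset.sum_comm]
    refine Finset.sum_congr rfl fun i _ => Finset.sum_congr rfl fun i' _ => by ring
  have hint : ∀ i i', Integrable (fun u => (inner ℝ (EuclideanSpace.single i (1 : ℝ)) u *
        inner ℝ (EuclideanSpace.single i' (1 : ℝ)) u) *
          (A (W i) ξ * B (W i') ξ * inner ℝ (W i) (W i'))) (isoGaussian m σ) := fun i i' =>
    ((memLp_inner_isoGaussian _ (q := 2) (by simp)).integrable_mul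
      (memLp_inner_isoGaussian _ (q := 2) (by simp))).mul_const _
  simp_rw [hexp]
  rw [integral_finsetSum _ fun i _ => integrable_finsetSum _ fun i' _ => hint i i']
  simp_rw [integral_finsetSum _ fun i' _ => hint _ i', integral_mul_const,
    integral_inner_mul_inner_isoGaussian, inner_basis]
  refine Finset.sum_congr rfl fun i _ => ?_
  rw [Finset.sum_eq_single i]
  · simp
    ring
  · intro i' _ hi'
    simp [hi'.symm]
  · simp

variable {κ : Measure Ξ} [IsProbabilityMeasure κ]

lemma measurable_inner_gatedSum (hA : Measurable (Function.uncurry A))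
    (hB : Measurable (Function.uncurry B)) :
    Measurable (Function.uncurry fun (W : Fin m → EuclideanSpace ℝ (Fin p)) v =>
      (m : ℝ)⁻¹ * inner ℝ (gatedSum A W v) (gatedSum B W v)) :=
  ((measurable_gatedSum hA).inner (measurable_gatedSum hB)).const_mul _

lemma integrable_norm_gatedSum_pow (hA : Measurable (Function.uncurry A))
    (hA1 : ∀ w ξ, |A w ξ| ≤ 1) (W : Fin m → EuclideanSpace ℝ (Fin p)) (q : ℕ) :
    Integrable (fun v => ‖gatedSum A W v‖ ^ q) (κ.prod (isoGaussian m σ)) := by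
  have h := ((integrable_norm_pow_isoGaussian (n := m) (σ := σ) q).comp_snd κ).mul_const
    ((∑ i, ‖W i‖) ^ q)
  refine h.mono' ?_ (ae_of_all _ fun v => ?_)
  · exact (((measurable_gatedSum hA).comp
      measurable_prodMk_left).norm.pow_const q).aestronglyMeasurable
  · rw [Real.norm_of_nonneg (by positivity), ← mul_pow]
    gcongr
    exact norm_gatedSum_le hA1 W v

lemma sq_inner_le_norm_pow_four {F : Type*} [NormedAddCommGroup F] [InnerProductSpace ℝ F]
    (x y : F) : inner ℝ x y ^ 2 ≤ 2⁻¹ * (‖x‖ ^ 4 + ‖y‖ ^ 4) := by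
  have h : inner ℝ x y ^ 2 ≤ (‖x‖ * ‖y‖) ^ 2 := by
    rw [← sq_abs]
    gcongr
    exact abs_real_inner_le_norm x y
  nlinarith [sq_nonneg (‖x‖ ^ 2 - ‖y‖ ^ 2)]

lemma memLp_inner_gatedSum (hA : Measurable (Function.uncurry A))
    (hB : Measurable (Function.uncurry B)) (hA1 : ∀ w ξ, |A w ξ| ≤ 1) (hB1 : ∀ w ξ, |B w ξ| ≤ 1)
    (W : Fin m → EuclideanSpace ℝ (Fin p)) :
    MemLp (fun v => (m : ℝ)⁻¹ * inner ℝ (gatedSum A W v) (gatedSum B W v)) 2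
      (κ.prod (isoGaussian m σ)) := by
  refine MemLp.const_mul ?_ _
  have hm : Measurable fun v => inner ℝ (gatedSum A W v) (gatedSum B W v) :=
    ((measurable_gatedSum hA).comp measurable_prodMk_left).inner
      ((measurable_gatedSum hB).comp measurable_prodMk_left)
  rw [memLp_two_iff_integrable_sq hm.aestronglyMeasurable]
  refine (((integrable_norm_gatedSum_pow hA hA1 W 4).add
    (integrable_norm_gatedSum_pow hB hB1 W 4)).const_mul 2⁻¹).mono'
    (hm.pow_const 2).aestronglyMeasurable (ae_of_all _ fun v => ?_)
  rw [Real.norm_of_nonneg (by positivity)]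
  exact sq_inner_le_norm_pow_four _ _

lemma integral_sq_inner_gatedSum_le (hA : Measurable (Function.uncurry A))
    (hB : Measurable (Function.uncurry B)) (hA1 : ∀ w ξ, |A w ξ| ≤ 1) (hB1 : ∀ w ξ, |B w ξ| ≤ 1)
    (W : Fin m → EuclideanSpace ℝ (Fin p)) :
    ∫ v, ((m : ℝ)⁻¹ * inner ℝ (gatedSum A W v) (gatedSum B W v)) ^ 2
      ∂(κ.prod (isoGaussian m σ)) ≤ (m : ℝ)⁻¹ * ∑ i, 3 * p ^ 2 * σ ^ 4 * ‖W i‖ ^ 4 := by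
  have hiA := integrable_norm_gatedSum_pow (κ := κ) (σ := σ) hA hA1 W 4
  have hiB := integrable_norm_gatedSum_pow (κ := κ) (σ := σ) hB hB1 W 4
  have hbd : ∀ {A' : EuclideanSpace ℝ (Fin p) → Ξ → ℝ},
      Integrable (fun v => ‖gatedSum A' W v‖ ^ 4) (κ.prod (isoGaussian m σ)) →
      (∀ w ξ, |A' w ξ| ≤ 1) →
      ∫ v, ‖gatedSum A' W v‖ ^ 4 ∂(κ.prod (isoGaussian m σ)) ≤
        3 * p ^ 2 * σ ^ 4 * (∑ i, ‖W i‖ ^ 2) ^ 2 := by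
    intro A' hi h1
    rw [integral_prod _ hi]
    refine (integral_mono_of_nonneg (ae_of_all _ fun ξ => by positivity) (integrable_const _)
      (ae_of_all _ fun ξ => integral_norm_gatedSum_pow_four_le h1 W ξ)).trans ?_
    simp
  -- The factor `m` lost here turns the prefactor `m⁻²` into `m⁻¹`, so the bound becomes an
  -- empirical average over the filters.
  have hsq : (∑ i, ‖W i‖ ^ 2) ^ 2 ≤ m * ∑ i, ‖W i‖ ^ 4 := by
    refine sq_sum_le_card_mul_sum_sq.trans ?_
    simp_rw [← pow_mul]
    simp
  calc ∫ v, ((m : ℝ)⁻¹ * inner ℝ (gatedSum A W v) (gatedSum B W v)) ^ 2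
        ∂(κ.prod (isoGaussian m σ))
      ≤ ∫ v, (m : ℝ)⁻¹ ^ 2 * (2⁻¹ * (‖gatedSum A W v‖ ^ 4 + ‖gatedSum B W v‖ ^ 4))
        ∂(κ.prod (isoGaussian m σ)) := by
        refine integral_mono_of_nonneg (ae_of_all _ fun v => by positivity)
          (((hiA.add hiB).const_mul _).const_mul _) (ae_of_all _ fun v => ?_)
        simp only [mul_pow]
        gcongr
        exact sq_inner_le_norm_pow_four _ _
    _ ≤ (m : ℝ)⁻¹ ^ 2 * (2⁻¹ * (3 * p ^ 2 * σ ^ 4 * (∑ i, ‖W i‖ ^ 2) ^ 2 +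
          3 * p ^ 2 * σ ^ 4 * (∑ i, ‖W i‖ ^ 2) ^ 2)) := by
        rw [integral_const_mul, integral_const_mul, integral_add hiA hiB]
        gcongr
        · exact hbd hiA hA1
        · exact hbd hiB hB1
    _ = 3 * p ^ 2 * σ ^ 4 * ((m : ℝ)⁻¹ ^ 2 * (∑ i, ‖W i‖ ^ 2) ^ 2) := by ring
    _ ≤ 3 * p ^ 2 * σ ^ 4 * ((m : ℝ)⁻¹ ^ 2 * (m * ∑ i, ‖W i‖ ^ 4)) := by gcongr
    _ = (m : ℝ)⁻¹ * ∑ i, 3 * p ^ 2 * σ ^ 4 * ‖W i‖ ^ 4 := by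
        rw [← Finset.mul_sum]
        -- For `m = 0` both sides vanish, by the convention `0⁻¹ = 0`.
        rcases eq_or_ne (m : ℝ) 0 with h | h
        · simp [h]
        · field_simp

lemma integral_prod_inner_gatedSum (hA : Measurable (Function.uncurry A))
    (hB : Measurable (Function.uncurry B)) (hA1 : ∀ w ξ, |A w ξ| ≤ 1) (hB1 : ∀ w ξ, |B w ξ| ≤ 1)
    (W : Fin m → EuclideanSpace ℝ (Fin p)) :
    ∫ v, (m : ℝ)⁻¹ * inner ℝ (gatedSum A W v) (gatedSum B W v) ∂(κ.prod (isoGaussian m σ)) =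
      (m : ℝ)⁻¹ * ∑ i, σ ^ 2 * ‖W i‖ ^ 2 * ∫ ξ, A (W i) ξ * B (W i) ξ ∂κ := by
  have hi := (memLp_inner_gatedSum (κ := κ) (σ := σ) hA hB hA1 hB1 W).integrable (by norm_num)
  rw [integral_prod _ hi]
  simp_rw [integral_const_mul, integral_inner_gatedSum]
  rw [integral_finsetSum]
  · simp_rw [integral_const_mul]
  · intro i _
    refine Integrable.const_mul ?_ _
    refine (integrable_const (1 : ℝ)).mono' ?_ (ae_of_all _ fun ξ => ?_)
    · exact ((hA.comp (measurable_prodMk_left (x := W i))).mul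
        (hB.comp (measurable_prodMk_left (x := W i)))).aestronglyMeasurable
    · rw [norm_mul]
      exact mul_le_one₀ (hA1 _ _) (norm_nonneg _) (hB1 _ _)

/-- The normalized inner product of two gated sums converges in probability. -/
theorem tendsto_measure_average_inner_gatedSum {γ : Measure (EuclideanSpace ℝ (Fin p))}
    [IsProbabilityMeasure γ] (hγ : Integrable (fun w => ‖w‖ ^ 4) γ)
    (hA : Measurable (Function.uncurry A)) (hB : Measurable (Function.uncurry B))
    (hA1 : ∀ w ξ, |A w ξ| ≤ 1) (hB1 : ∀ w ξ, |B w ξ| ≤ 1) {δ : ℝ} (hδ : 0 < δ) :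
    Tendsto (fun n : ℕ × ℕ => ((Measure.pi fun _ : Fin n.2 => γ).prod
        (Measure.pi fun _ : Fin n.1 => κ.prod (isoGaussian n.2 σ)))
        {ω | δ ≤ |(n.1 : ℝ)⁻¹ * ∑ j, (n.2 : ℝ)⁻¹ *
            inner ℝ (gatedSum A ω.1 (ω.2 j)) (gatedSum B ω.1 (ω.2 j)) -
          ∫ w, σ ^ 2 * ‖w‖ ^ 2 * ∫ ξ, A w ξ * B w ξ ∂κ ∂γ|})
      (atTop ×ˢ atTop) (𝓝 0) := by
  set h : EuclideanSpace ℝ (Fin p) → ℝ := fun w => σ ^ 2 * ‖w‖ ^ 2 * ∫ ξ, A w ξ * B w ξ ∂κ with hdef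
  have hh : Measurable h := by
    refine Measurable.mul (by fun_prop) ?_
    exact (StronglyMeasurable.integral_prod_right (ν := κ)
      (f := fun w ξ => A w ξ * B w ξ) (hA.mul hB).stronglyMeasurable).measurable
  have hint1 : ∀ w, |∫ ξ, A w ξ * B w ξ ∂κ| ≤ 1 := by
    intro w
    have := norm_integral_le_of_norm_le_const (μ := κ) (f := fun ξ => A w ξ * B w ξ) (C := 1)
      (ae_of_all _ fun ξ => by
        rw [norm_mul]
        exact mul_le_one₀ (hA1 _ _) (norm_nonneg _) (hB1 _ _))
    simpa using this
  have hh2 : MemLp h 2 γ := by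
    rw [memLp_two_iff_integrable_sq hh.aestronglyMeasurable]
    refine (hγ.const_mul (σ ^ 4)).mono' (hh.pow_const 2).aestronglyMeasurable
      (ae_of_all _ fun w => ?_)
    rw [Real.norm_of_nonneg (by positivity), hdef]
    calc (σ ^ 2 * ‖w‖ ^ 2 * ∫ ξ, A w ξ * B w ξ ∂κ) ^ 2
        = σ ^ 4 * ‖w‖ ^ 4 * (∫ ξ, A w ξ * B w ξ ∂κ) ^ 2 := by ring
      _ ≤ σ ^ 4 * ‖w‖ ^ 4 * 1 := by
        gcongr
        exact (sq_le_one_iff_abs_le_one _).2 (hint1 w)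
      _ = _ := mul_one _
  set G : EuclideanSpace ℝ (Fin p) → ℝ := fun w => 3 * p ^ 2 * σ ^ 4 * ‖w‖ ^ 4
  have hlim : ∀ C : ℝ,
      Tendsto (fun n : ℕ => ENNReal.ofReal (C / (n * (δ / 2) ^ 2))) atTop (𝓝 0) := by
    intro C
    rw [← ENNReal.ofReal_zero]
    refine ENNReal.tendsto_ofReal (Tendsto.div_atTop tendsto_const_nhds ?_)
    exact tendsto_natCast_atTop_atTop.atTop_mul_const (by positivity)
  -- One error term depends on `k` alone and the other on `m` alone, which is why the joint limit
  -- needs no relation between them.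
  have hsum := ((hlim (∫ w, G w ∂γ)).comp (tendsto_fst (f := atTop) (g := atTop (α := ℕ)))).add
    ((hlim (∫ w, h w ^ 2 ∂γ)).comp (tendsto_snd (f := atTop (α := ℕ)) (g := atTop)))
  rw [add_zero] at hsum
  refine tendsto_of_tendsto_of_tendsto_of_le_of_le' tendsto_const_nhds hsum
    (Eventually.of_forall fun _ => zero_le) ?_
  filter_upwards [prod_mem_prod (eventually_gt_atTop 0) (eventually_gt_atTop 0)] with n hn
  exact prod_average_sub_ge_le (Y := fun W v => (n.2 : ℝ)⁻¹ *
      inner ℝ (gatedSum A W v) (gatedSum B W v)) hn.1 hn.2 (measurable_inner_gatedSum hA hB)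
    (memLp_inner_gatedSum hA hB hA1 hB1) (hγ.const_mul _) (fun w => by positivity)
    (integral_sq_inner_gatedSum_le hA hB hA1 hB1) hh hh2
    (integral_prod_inner_gatedSum hA hB hA1 hB1) hδ

end RandomFeatures

/-! ### The gradient of the network -/

section Gradient

variable {p k m : ℕ}

/-- The derivative of the ReLU at the pre-activation `⟪w, x⟫`. -/
noncomputable def gate (w x : EuclideanSpace ℝ (Fin p)) : ℝ := if 0 < inner ℝ w x then 1 else 0

lemma inner_vec_vec (X Y : Fin k → EuclideanSpace ℝ (Fin p)) :
    inner ℝ (vec X) (vec Y) = ∑ j, inner ℝ (X j) (Y j) := by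
  simp only [vec, PiLp.inner_apply, Fintype.sum_prod_type]

/-- Placing `w` in block `j` is adjoint to extracting patch `j`; this exhibits the gradient of each
pre-activation. -/
lemma inner_vec_single (j : Fin k) (w : EuclideanSpace ℝ (Fin p)) (x : Image p k) :
    inner ℝ (vec (Pi.single j w)) x = inner ℝ w (patch x j) := by
  simp only [vec, patch, PiLp.inner_apply, Fintype.sum_prod_type]
  rw [Finset.sum_eq_single j]
  · simp
  · intro j' _ hj'
    simp [Pi.single_eq_of_ne hj']
  · simp

lemma vec_eq_sum_single (X : Fin k → EuclideanSpace ℝ (Fin p)) :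
    vec X = ∑ j, vec (Pi.single j (X j)) := by
  ext ⟨j, a⟩
  simp only [vec, WithLp.ofLp_sum, Finset.sum_apply]
  rw [Finset.sum_eq_single j]
  · simp
  · intro j' _ hj'
    simp [Pi.single_eq_of_ne hj'.symm]
  · simp

lemma hasFDerivAt_max_zero {F : Type*} [NormedAddCommGroup F] [NormedSpace ℝ F] (l : F →L[ℝ] ℝ)
    {x : F} (hx : l x ≠ 0) :
    HasFDerivAt (fun x' => max (l x') 0) ((if 0 < l x then (1 : ℝ) else 0) • l) x := by
  rcases hx.lt_or_gt with h | h
  · rw [if_neg h.not_gt, zero_smul]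
    refine (hasFDerivAt_const (0 : ℝ) x).congr_of_eventuallyEq ?_
    filter_upwards [l.continuous.continuousAt.eventually_lt continuousAt_const h] with x' hx'
    exact max_eq_right hx'.le
  · rw [if_pos h, one_smul]
    refine l.hasFDerivAt.congr_of_eventuallyEq ?_
    filter_upwards [continuousAt_const.eventually_lt l.continuous.continuousAt h] with x' hx'
    exact max_eq_left hx'.le

lemma hasGradientAt_cnn (W : Fin m → EuclideanSpace ℝ (Fin p))
    (U : Fin k → EuclideanSpace ℝ (Fin m)) (c : ℝ) {x : Image p k}
    (hx : ∀ i j, inner ℝ (W i) (patch x j) ≠ 0) :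
    HasGradientAt (cnn W 0 U c)
      (vec fun j => ∑ i, (U j i * gate (W i) (patch x j)) • W i) x := by
  rw [hasGradientAt_iff_hasFDerivAt]
  have hterm : ∀ i j, HasFDerivAt (fun x' : Image p k =>
      U j i * max (inner ℝ (W i) (patch x' j) + (0 : Fin m → ℝ) i) 0)
      (U j i • (gate (W i) (patch x j) • innerSL ℝ (vec (Pi.single j (W i))))) x := by
    intro i j
    have h := (hasFDerivAt_max_zero (innerSL ℝ (vec (Pi.single j (W i)))) (x := x) (by
      rw [innerSL_apply_apply, inner_vec_single]; exact hx i j)).const_mul (U j i)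
    simp only [innerSL_apply_apply, inner_vec_single] at h
    simp only [Pi.zero_apply, add_zero]
    exact h
  have h := (HasFDerivAt.fun_sum (u := Finset.univ) fun i _ =>
    HasFDerivAt.fun_sum (u := Finset.univ) fun j _ => hterm i j).add_const c
  unfold cnn
  refine h.congr_fderiv ?_
  ext y
  rw [InnerProductSpace.toDual_apply_apply, vec_eq_sum_single, sum_inner]
  simp only [_root_.sum_apply, _root_.smul_apply, innerSL_apply_apply,
    inner_vec_single, smul_eq_mul, sum_inner, real_inner_smul_left]
  rw [Finset.sum_comm]
  exact Finset.sum_congr rfl fun j _ => Finset.sum_congr rfl fun i _ => by ring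

lemma lossGrad_eq_smul {Y : Type*} {loss : ℝ → Y → ℝ} (W : Fin m → EuclideanSpace ℝ (Fin p))
    (U : Fin k → EuclideanSpace ℝ (Fin m)) (c : ℝ) {x : Image p k} {y : Y}
    (hdiff : Differentiable ℝ fun t => loss t y)
    (hx : ∀ i j, inner ℝ (W i) (patch x j) ≠ 0) :
    lossGrad loss W 0 U c x y = deriv (fun t => loss t y) (cnn W 0 U c x) •
      (vec fun j => ∑ i, (U j i * gate (W i) (patch x j)) • W i) := by
  refine HasGradientAt.gradient ?_
  rw [hasGradientAt_iff_hasFDerivAt, map_smulₛₗ]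
  exact (hdiff _).hasDerivAt.comp_hasFDerivAt x
    (hasGradientAt_iff_hasFDerivAt.1 (hasGradientAt_cnn W U c hx))

/-- The derivatives of the loss at the two outputs may differ in size; a common sign is enough to
cancel them. -/
lemma cosine_smul_smul {F : Type*} [NormedAddCommGroup F] [InnerProductSpace ℝ F] {a b : ℝ}
    (hab : 0 < a * b) (x y : F) : cosine (a • x) (b • y) = cosine x y := by
  have hne : |a| * |b| ≠ 0 := by rw [← abs_mul]; exact abs_ne_zero.2 hab.ne'
  rw [cosine, cosine, real_inner_smul_left, real_inner_smul_right, norm_smul, norm_smul,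
    Real.norm_eq_abs, Real.norm_eq_abs, ← mul_assoc, ← abs_of_pos hab, abs_mul,
    show |a| * ‖x‖ * (|b| * ‖y‖) = |a| * |b| * (‖x‖ * ‖y‖) by ring, mul_div_mul_left _ _ hne]

/-- The gates of the clean patch. -/
noncomputable def cleanGate (w : EuclideanSpace ℝ (Fin p))
    (ξ : EuclideanSpace ℝ (Fin p) × EuclideanSpace ℝ (Fin p)) : ℝ := gate w ξ.1

/-- The gates of the noisy patch. -/
noncomputable def noisyGate (w : EuclideanSpace ℝ (Fin p))
    (ξ : EuclideanSpace ℝ (Fin p) × EuclideanSpace ℝ (Fin p)) : ℝ := gate w (ξ.1 + ξ.2)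

/-- The normalized inner product of two gated sums over all patches. -/
noncomputable def averageInner {Ξ : Type*} (A B : EuclideanSpace ℝ (Fin p) → Ξ → ℝ)
    (ω : (Fin m → EuclideanSpace ℝ (Fin p)) × (Fin k → Ξ × EuclideanSpace ℝ (Fin m))) : ℝ :=
  (k : ℝ)⁻¹ * ∑ j, (m : ℝ)⁻¹ * inner ℝ (gatedSum A ω.1 (ω.2 j)) (gatedSum B ω.1 (ω.2 j))

/-- Regroup a sample as the filters together with the data attached to each patch. -/
noncomputable def regroup (s : Sample p k m) : (Fin m → EuclideanSpace ℝ (Fin p)) ×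
    (Fin k → (EuclideanSpace ℝ (Fin p) × EuclideanSpace ℝ (Fin p)) × EuclideanSpace ℝ (Fin m)) :=
  (s.2.1, fun j => ((s.1.1 j, patch s.1.2 j), s.2.2 j))

lemma alignment_eq {Y : Type*} {loss : ℝ → Y → ℝ} (c : ℝ) {y : Y}
    (hdiff : Differentiable ℝ fun t => loss t y)
    (hsign : (∀ t, 0 < deriv (fun t' => loss t' y) t) ∨ (∀ t, deriv (fun t' => loss t' y) t < 0))
    (hk : 0 < k) (hm : 0 < m) {s : Sample p k m}
    (hs : ∀ i j, inner ℝ (s.2.1 i) (s.1.1 j) ≠ 0 ∧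
      inner ℝ (s.2.1 i) (s.1.1 j + patch s.1.2 j) ≠ 0) :
    alignment loss c y s = averageInner cleanGate noisyGate (regroup s) /
      (√(averageInner cleanGate cleanGate (regroup s)) *
        √(averageInner noisyGate noisyGate (regroup s))) := by
  have hpos : ∀ t t', 0 < deriv (fun t' => loss t' y) t * deriv (fun t' => loss t' y) t' := by
    intro t t'
    rcases hsign with h | h
    · exact mul_pos (h t) (h t')
    · exact mul_pos_of_neg_of_neg (h t) (h t')
  have hpv : ∀ j, patch (vec s.1.1) j = s.1.1 j := fun j => rfl
  have hpn : ∀ j, patch (vec s.1.1 + s.1.2) j = s.1.1 j + patch s.1.2 j := fun j => rfl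
  -- All three averages carry the same factor `(k m)⁻¹`, which cancels in the cosine.
  have havg : ∀ A B : EuclideanSpace ℝ (Fin p) → _ → ℝ, averageInner A B (regroup s) =
      ((k : ℝ) * m)⁻¹ * inner ℝ (vec fun j => gatedSum A s.2.1 ((regroup s).2 j))
        (vec fun j => gatedSum B s.2.1 ((regroup s).2 j)) := by
    intro A B
    rw [averageInner, inner_vec_vec, ← Finset.mul_sum, ← mul_assoc, mul_inv]
    rfl
  rw [alignment, lossGrad_eq_smul _ _ _ hdiff (fun i j => by rw [hpv]; exact (hs i j).1),
    lossGrad_eq_smul _ _ _ hdiff (fun i j => by rw [hpn]; exact (hs i j).2),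
    cosine_smul_smul (hpos _ _), cosine, havg, havg, havg, real_inner_self_eq_norm_sq,
    real_inner_self_eq_norm_sq, Real.sqrt_mul' _ (sq_nonneg _), Real.sqrt_mul' _ (sq_nonneg _),
    Real.sqrt_sq (norm_nonneg _), Real.sqrt_sq (norm_nonneg _)]
  have hkm : (0 : ℝ) < ((k : ℝ) * m)⁻¹ := by positivity
  rw [mul_mul_mul_comm, Real.mul_self_sqrt hkm.le, mul_div_mul_left _ _ hkm.ne']
  rfl

end Gradient

/-! ### The joint law -/

section Law

variable {p k m : ℕ} {σw σu ε : ℝ}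

/-- The law lists patches, noise and output weights separately. Collecting them patch by patch gives
i.i.d. triples independent of `W`, the form required by the two-stage law of large numbers. -/
lemma measurePreserving_regroup (hε : 0 < ε) :
    MeasurePreserving (regroup (p := p) (k := k) (m := m)) (law p k m σw σu ε)
      ((Measure.pi fun _ : Fin m => isoGaussian p σw).prod
        (Measure.pi fun _ : Fin k => ((uniformCube (Fin p) 0 1).prod
          (uniformCube (Fin p) (-ε) ε)).prod (isoGaussian m σu))) := by
  have h01 := isProbabilityMeasure_uniformCube (ι := Fin p) (zero_lt_one (α := ℝ))
  have hεε : -ε < ε := by linarith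
  have hp := isProbabilityMeasure_uniformCube (ι := Fin p) hεε
  have hkp := isProbabilityMeasure_uniformCube (ι := Fin k × Fin p) hεε
  have e1 := ((MeasurePreserving.id (Measure.pi fun _ : Fin k => uniformCube (Fin p) 0 1)).prod
    (measurePreserving_patch (p := p) (k := k) hεε))
  have e2 := (measurePreserving_arrowProdEquivProdArrow (EuclideanSpace ℝ (Fin p))
    (EuclideanSpace ℝ (Fin p)) (Fin k) (fun _ => uniformCube (Fin p) 0 1)
    (fun _ => uniformCube (Fin p) (-ε) ε)).symm
  have e3 := (e2.comp e1).prod (MeasurePreserving.id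
    ((Measure.pi fun _ : Fin m => isoGaussian p σw).prod
      (Measure.pi fun _ : Fin k => isoGaussian m σu)))
  have e4 := (measurePreserving_prodAssoc (Measure.pi fun _ : Fin m => isoGaussian p σw)
    (Measure.pi fun _ : Fin k => isoGaussian m σu)
    (Measure.pi fun _ : Fin k => (uniformCube (Fin p) 0 1).prod (uniformCube (Fin p) (-ε) ε))).comp
    (Measure.measurePreserving_swap.comp e3)
  have e5 := (measurePreserving_arrowProdEquivProdArrow
    (EuclideanSpace ℝ (Fin p) × EuclideanSpace ℝ (Fin p)) (EuclideanSpace ℝ (Fin m)) (Fin k)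
    (fun _ => (uniformCube (Fin p) 0 1).prod (uniformCube (Fin p) (-ε) ε))
    (fun _ => isoGaussian m σu)).symm
  exact ((MeasurePreserving.id (Measure.pi fun _ : Fin m => isoGaussian p σw)).prod
    (e5.comp Measure.measurePreserving_swap)).comp e4

/-- Fubini with the Gaussian integrated first: for fixed `f ξ ≠ 0` the pre-activation is a
nondegenerate Gaussian. -/
lemma ae_inner_ne_zero_prod {Ξ : Type*} [MeasurableSpace Ξ] {κ : Measure Ξ}
    [IsProbabilityMeasure κ] (hσw : 0 < σw) {f : Ξ → EuclideanSpace ℝ (Fin p)} (hf : Measurable f)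
    (hne : ∀ᵐ ξ ∂κ, f ξ ≠ 0) :
    ∀ᵐ q ∂((isoGaussian p σw).prod κ), inner ℝ q.1 (f q.2) ≠ 0 := by
  have hmeas : MeasurableSet {q : Ξ × EuclideanSpace ℝ (Fin p) | inner ℝ q.2 (f q.1) ≠ (0 : ℝ)} :=
    ((measurableSet_singleton (0 : ℝ)).preimage
      (measurable_snd.inner (hf.comp measurable_fst))).compl
  have hswap : ∀ᵐ q ∂(κ.prod (isoGaussian p σw)), inner ℝ q.2 (f q.1) ≠ 0 := by
    refine (Measure.ae_prod_iff_ae_ae hmeas).2 ?_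
    filter_upwards [hne] with ξ hξ
    exact ae_inner_ne_zero_isoGaussian hσw hξ
  exact Measure.measurePreserving_swap.quasiMeasurePreserving.ae hswap

lemma ae_inner_ne_zero (hp : 2 ≤ p) (hσw : 0 < σw) (hε : 0 < ε) :
    ∀ᵐ q ∂((isoGaussian p σw).prod
      ((uniformCube (Fin p) 0 1).prod (uniformCube (Fin p) (-ε) ε))),
      inner ℝ q.1 q.2.1 ≠ 0 ∧ inner ℝ q.1 (q.2.1 + q.2.2) ≠ 0 := by
  have h01 := isProbabilityMeasure_uniformCube (ι := Fin p) (zero_lt_one (α := ℝ))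
  have hεε : -ε < ε := by linarith
  have hprob := isProbabilityMeasure_uniformCube (ι := Fin p) hεε
  -- Positive dimension makes Lebesgue measure, and hence the uniform law, atomless.
  have : Nonempty (Fin p) := ⟨⟨0, by omega⟩⟩
  have hne : ∀ {a b : ℝ} (x : EuclideanSpace ℝ (Fin p)), ∀ᵐ v ∂(uniformCube (Fin p) a b), v ≠ x :=
    fun x => uniformCube_absolutelyContinuous.ae_le (compl_mem_ae_iff.2 (measure_singleton x))
  have hκ : ∀ᵐ ξ ∂((uniformCube (Fin p) 0 1).prod (uniformCube (Fin p) (-ε) ε)),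
      ξ.1 ≠ 0 ∧ ξ.1 + ξ.2 ≠ 0 := by
    have hmeas : MeasurableSet {ξ : EuclideanSpace ℝ (Fin p) × EuclideanSpace ℝ (Fin p) |
        ξ.1 ≠ 0 ∧ ξ.1 + ξ.2 ≠ 0} := by
      refine MeasurableSet.inter (MeasurableSet.compl ?_) (MeasurableSet.compl ?_)
      · exact measurableSet_eq_fun measurable_fst measurable_const
      · exact measurableSet_eq_fun (measurable_fst.add measurable_snd) measurable_const
    refine (Measure.ae_prod_iff_ae_ae hmeas).2 ?_
    · filter_upwards [hne 0] with z hz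
      filter_upwards [hne (-z)] with e he
      exact ⟨hz, fun h => he (eq_neg_of_add_eq_zero_right h)⟩
  have h1 := ae_inner_ne_zero_prod (f := fun ξ => ξ.1) hσw measurable_fst (hκ.mono fun _ h => h.1)
  have h2 := ae_inner_ne_zero_prod (f := fun ξ => ξ.1 + ξ.2) hσw
    (measurable_fst.add measurable_snd) (hκ.mono fun _ h => h.2)
  filter_upwards [h1, h2] with q hq1 hq2
  exact ⟨hq1, hq2⟩

lemma ae_law_inner_ne_zero (hp : 2 ≤ p) (hσw : 0 < σw) (hε : 0 < ε) :
    ∀ᵐ s ∂(law p k m σw σu ε), ∀ i j, inner ℝ (s.2.1 i) (s.1.1 j) ≠ 0 ∧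
      inner ℝ (s.2.1 i) (s.1.1 j + patch s.1.2 j) ≠ 0 := by
  have h01 := isProbabilityMeasure_uniformCube (ι := Fin p) (zero_lt_one (α := ℝ))
  have hεε : -ε < ε := by linarith
  have hprob := isProbabilityMeasure_uniformCube (ι := Fin p) hεε
  refine ae_all_iff.2 fun i => ae_all_iff.2 fun j => ?_
  have hmp := ((measurePreserving_eval (fun _ : Fin m => isoGaussian p σw) i).prod
    (measurePreserving_fst.comp (measurePreserving_eval (fun _ : Fin k =>
      ((uniformCube (Fin p) 0 1).prod (uniformCube (Fin p) (-ε) ε)).prod (isoGaussian m σu))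
        j))).comp (measurePreserving_regroup (σw := σw) (σu := σu) hε)
  exact hmp.quasiMeasurePreserving.ae (ae_inner_ne_zero hp hσw hε)

end Law

/-! ### The limit of the alignment -/

section Limit

variable {p : ℕ} {σw σu ε : ℝ}

lemma measurable_gate_comp {Ξ : Type*} [MeasurableSpace Ξ] {f : Ξ → EuclideanSpace ℝ (Fin p)}
    (hf : Measurable f) :
    Measurable fun q : EuclideanSpace ℝ (Fin p) × Ξ => gate q.1 (f q.2) :=
  Measurable.ite (measurableSet_lt measurable_const
    (measurable_fst.inner (hf.comp measurable_snd))) measurable_const measurable_const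

lemma measurable_cleanGate : Measurable (Function.uncurry (cleanGate (p := p))) :=
  measurable_gate_comp measurable_fst

lemma measurable_noisyGate : Measurable (Function.uncurry (noisyGate (p := p))) :=
  measurable_gate_comp (measurable_fst.add measurable_snd)

lemma abs_gate_le_one (w x : EuclideanSpace ℝ (Fin p)) : |gate w x| ≤ 1 := by
  unfold gate; split_ifs <;> simp

lemma abs_cleanGate_le_one (w : EuclideanSpace ℝ (Fin p))
    (ξ : EuclideanSpace ℝ (Fin p) × EuclideanSpace ℝ (Fin p)) : |cleanGate w ξ| ≤ 1 :=
  abs_gate_le_one _ _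

lemma abs_noisyGate_le_one (w : EuclideanSpace ℝ (Fin p))
    (ξ : EuclideanSpace ℝ (Fin p) × EuclideanSpace ℝ (Fin p)) : |noisyGate w ξ| ≤ 1 :=
  abs_gate_le_one _ _

/-- Indicator of the event that the noise flips the sign of the pre-activation. -/
noncomputable def signFlip (w : EuclideanSpace ℝ (Fin p))
    (ξ : EuclideanSpace ℝ (Fin p) × EuclideanSpace ℝ (Fin p)) : ℝ :=
  if inner ℝ w ξ.1 * inner ℝ w (ξ.1 + ξ.2) < 0 then 1 else 0

lemma measurable_signFlip : Measurable (Function.uncurry (signFlip (p := p))) := by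
  refine Measurable.ite (measurableSet_lt (Measurable.mul ?_ ?_) measurable_const)
    measurable_const measurable_const
  · exact measurable_fst.inner (measurable_fst.comp measurable_snd)
  · exact measurable_fst.inner ((measurable_fst.add measurable_snd).comp measurable_snd)

lemma signFlip_nonneg (w : EuclideanSpace ℝ (Fin p))
    (ξ : EuclideanSpace ℝ (Fin p) × EuclideanSpace ℝ (Fin p)) : 0 ≤ signFlip w ξ := by
  unfold signFlip; split_ifs <;> simp

lemma abs_signFlip_le_one (w : EuclideanSpace ℝ (Fin p))
    (ξ : EuclideanSpace ℝ (Fin p) × EuclideanSpace ℝ (Fin p)) : |signFlip w ξ| ≤ 1 := by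
  unfold signFlip; split_ifs <;> simp

lemma gate_mul_self_add_neg {w x : EuclideanSpace ℝ (Fin p)} (h : inner ℝ w x ≠ 0) :
    gate w x * gate w x + gate (-w) x * gate (-w) x = 1 := by
  unfold gate
  rcases h.lt_or_gt with h | h <;> simp [inner_neg_left, h, h.not_gt]

/-- If the two pre-activations agree in sign, exactly one of `w`, `-w` is active at both points;
otherwise neither is. -/
lemma gate_mul_gate_add_neg {w x y : EuclideanSpace ℝ (Fin p)} (hx : inner ℝ w x ≠ 0)
    (hy : inner ℝ w y ≠ 0) :
    gate w x * gate w y + gate (-w) x * gate (-w) y =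
      1 - if inner ℝ w x * inner ℝ w y < 0 then 1 else 0 := by
  unfold gate
  rcases hx.lt_or_gt with hx | hx <;> rcases hy.lt_or_gt with hy | hy
  · simp [inner_neg_left, hx, hy, hx.not_gt, (mul_pos_of_neg_of_neg hx hy).not_gt]
  · simp [inner_neg_left, hx, hy, hx.not_gt, hy.not_gt, mul_neg_of_neg_of_pos hx hy]
  · simp [inner_neg_left, hx, hy, hx.not_gt, hy.not_gt, mul_neg_of_pos_of_neg hx hy]
  · simp [inner_neg_left, hx, hy, hx.not_gt, (mul_pos hx hy).not_gt]

section Weighted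

variable {Ξ : Type*} [MeasurableSpace Ξ] {κ : Measure Ξ} [IsProbabilityMeasure κ]

lemma integrable_norm_sq_mul {f : EuclideanSpace ℝ (Fin p) × Ξ → ℝ} (hf : Measurable f)
    (hf1 : ∀ q, |f q| ≤ 1) :
    Integrable (fun q => ‖q.1‖ ^ 2 * f q) ((isoGaussian p σw).prod κ) := by
  refine ((integrable_norm_pow_isoGaussian (n := p) (σ := σw) 2).comp_fst κ).mono'
    ((measurable_fst.norm.pow_const 2).mul hf).aestronglyMeasurable (ae_of_all _ fun q => ?_)
  rw [norm_mul, Real.norm_of_nonneg (sq_nonneg _)]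
  exact mul_le_of_le_one_right (sq_nonneg _) (hf1 q)

lemma integral_norm_sq_fst :
    ∫ q, ‖q.1‖ ^ 2 ∂((isoGaussian p σw).prod κ) = p * σw ^ 2 := by
  rw [integral_fun_fst (f := fun w : EuclideanSpace ℝ (Fin p) => ‖w‖ ^ 2)]
  simp [integral_norm_sq_isoGaussian]

/-- Symmetrization of a weighted integral over the sign of the Gaussian vector. -/
lemma two_mul_integral_norm_sq_mul {f g : EuclideanSpace ℝ (Fin p) × Ξ → ℝ} (hf : Measurable f)
    (hf1 : ∀ q, |f q| ≤ 1)
    (hfg : ∀ᵐ q ∂((isoGaussian p σw).prod κ), f q + f (-q.1, q.2) = g q) :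
    2 * ∫ q, ‖q.1‖ ^ 2 * f q ∂((isoGaussian p σw).prod κ) =
      ∫ q, ‖q.1‖ ^ 2 * g q ∂((isoGaussian p σw).prod κ) := by
  have hmp : MeasurePreserving (fun q : EuclideanSpace ℝ (Fin p) × Ξ => (-q.1, q.2))
      ((isoGaussian p σw).prod κ) ((isoGaussian p σw).prod κ) :=
    measurePreserving_neg_isoGaussian.prod (MeasurePreserving.id κ)
  have hint := integrable_norm_sq_mul (σw := σw) (κ := κ) hf hf1
  have hint' : Integrable (fun q => ‖q.1‖ ^ 2 * f (-q.1, q.2)) ((isoGaussian p σw).prod κ) :=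
    integrable_norm_sq_mul (hf.comp hmp.measurable) fun q => hf1 _
  have hneg : ∫ q, ‖q.1‖ ^ 2 * f q ∂((isoGaussian p σw).prod κ) =
      ∫ q, ‖q.1‖ ^ 2 * f (-q.1, q.2) ∂((isoGaussian p σw).prod κ) := by
    have hm : AEStronglyMeasurable (fun q => ‖q.1‖ ^ 2 * f q)
        (((isoGaussian p σw).prod κ).map fun q => (-q.1, q.2)) :=
      ((measurable_fst.norm.pow_const 2).mul hf).aestronglyMeasurable
    have h := integral_map hmp.measurable.aemeasurable hm
    rw [hmp.map_eq] at h
    simpa using h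
  rw [two_mul]
  nth_rewrite 2 [hneg]
  rw [← integral_add hint hint']
  refine integral_congr_ae ?_
  filter_upwards [hfg] with q hq
  rw [← hq]
  ring

lemma integral_integral_norm_sq_mul {f : EuclideanSpace ℝ (Fin p) → Ξ → ℝ}
    (hf : Measurable (Function.uncurry f)) (hf1 : ∀ w ξ, |f w ξ| ≤ 1) :
    ∫ w, σu ^ 2 * ‖w‖ ^ 2 * ∫ ξ, f w ξ ∂κ ∂(isoGaussian p σw) =
      σu ^ 2 * ∫ q, ‖q.1‖ ^ 2 * f q.1 q.2 ∂((isoGaussian p σw).prod κ) := by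
  rw [integral_prod _ (integrable_norm_sq_mul (f := fun q => f q.1 q.2) hf fun q => hf1 _ _)]
  simp_rw [integral_const_mul, mul_assoc, integral_const_mul]

end Weighted

/-! ### Bounds on the probability of a sign flip, and the limiting constants. -/

lemma integral_signFlip_eq (w z : EuclideanSpace ℝ (Fin p)) :
    ∫ e, signFlip w (z, e) ∂(uniformCube (Fin p) (-ε) ε) =
      (uniformCube (Fin p) (-ε) ε).real {e | inner ℝ w z * inner ℝ w (z + e) < 0} := by
  have hmeas : MeasurableSet {e : EuclideanSpace ℝ (Fin p) |
      inner ℝ w z * inner ℝ w (z + e) < 0} :=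
    measurableSet_lt (by fun_prop) measurable_const
  rw [← integral_indicator_one hmeas]
  refine integral_congr_ae (ae_of_all _ fun e => ?_)
  simp [signFlip, Set.indicator_apply]

/-- A flip forces `⟪w, e⟫` to have the sign opposite to `⟪w, z⟫`. Under the symmetric noise this
event is as likely as the disjoint event of equal signs. -/
lemma integral_signFlip_le_half (hε : 0 < ε) (w z : EuclideanSpace ℝ (Fin p)) :
    ∫ e, signFlip w (z, e) ∂(uniformCube (Fin p) (-ε) ε) ≤ 1 / 2 := by
  have hprob := isProbabilityMeasure_uniformCube (ι := Fin p) (show -ε < ε by linarith)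
  rw [integral_signFlip_eq]
  set ν := uniformCube (Fin p) (-ε) ε
  set a : ℝ := inner ℝ w z
  have hneg : MeasurableSet {e : EuclideanSpace ℝ (Fin p) | a * inner ℝ w e < 0} :=
    measurableSet_lt (by fun_prop) measurable_const
  have hpos : MeasurableSet {e : EuclideanSpace ℝ (Fin p) | 0 < a * inner ℝ w e} :=
    measurableSet_lt measurable_const (by fun_prop)
  have hsub : ν.real {e | a * inner ℝ w (z + e) < 0} ≤ ν.real {e | a * inner ℝ w e < 0} := by
    refine measureReal_mono fun e he => ?_
    simp only [Set.mem_ofPred_eq, inner_add_right] at he ⊢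
    nlinarith [sq_nonneg a]
  have hsymm : ν.real {e | a * inner ℝ w e < 0} = ν.real {e | 0 < a * inner ℝ w e} := by
    have h := (measurePreserving_neg_uniformCube (ι := Fin p) (ε := ε)).measureReal_preimage
      hpos.nullMeasurableSet
    rw [← h]
    congr 1
    ext e
    simp
  have hdisj : Disjoint {e : EuclideanSpace ℝ (Fin p) | a * inner ℝ w e < 0}
      {e | 0 < a * inner ℝ w e} := by
    rw [Set.disjoint_left]
    intro e h1 h2
    simp only [Set.mem_ofPred_eq] at h1 h2
    exact lt_asymm h1 h2
  have hunion := measureReal_union (μ := ν) hdisj hpos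
  have hle : ν.real ({e | a * inner ℝ w e < 0} ∪ {e | 0 < a * inner ℝ w e}) ≤ 1 :=
    measureReal_le_one
  linarith

/-- A flip needs `⟪w, e⟫` to exceed `|⟪w, z⟫|` against the sign of `⟪w, z⟫`, and Hoeffding bounds
that tail. At `w = 0` both exponents are `0` under the division convention. -/
lemma integral_signFlip_le_exp (hε : 0 < ε) (w z : EuclideanSpace ℝ (Fin p)) :
    ∫ e, signFlip w (z, e) ∂(uniformCube (Fin p) (-ε) ε) ≤
      Real.exp (-(1 / (2 * ε ^ 2)) * inner ℝ (‖w‖⁻¹ • w) z ^ 2) := by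
  have hprob := isProbabilityMeasure_uniformCube (ι := Fin p) (show -ε < ε by linarith)
  rw [integral_signFlip_eq, real_inner_smul_left]
  set a : ℝ := inner ℝ w z
  have hexp : -(1 / (2 * ε ^ 2)) * (‖w‖⁻¹ * a) ^ 2 = -|a| ^ 2 / (2 * (ε ^ 2 * ‖w‖ ^ 2)) := by
    rw [sq_abs]; ring
  rw [hexp]
  rcases le_or_gt a 0 with ha | ha
  · refine (measureReal_mono fun e he => ?_).trans
      (uniformCube_real_le_inner hε w (abs_nonneg a))
    simp only [Set.mem_ofPred_eq, inner_add_right] at he ⊢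
    rw [abs_of_nonpos ha]
    have := pos_of_mul_neg_right he ha
    linarith
  · have h := uniformCube_real_le_inner hε (-w) (abs_nonneg a)
    rw [norm_neg] at h
    refine (measureReal_mono fun e he => ?_).trans h
    simp only [Set.mem_ofPred_eq, inner_add_right, inner_neg_left] at he ⊢
    rw [abs_of_pos ha]
    have := neg_of_mul_neg_right he ha.le
    linarith

/-- The weighted probability of a sign flip is controlled by any bound on the conditional
probability of a flip. -/
lemma integral_norm_sq_mul_signFlip_le (hε : 0 < ε)
    {b : EuclideanSpace ℝ (Fin p) × EuclideanSpace ℝ (Fin p) → ℝ} (hb : Measurable b)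
    (hb1 : ∀ q, |b q| ≤ 1)
    (hle : ∀ w z, ∫ e, signFlip w (z, e) ∂(uniformCube (Fin p) (-ε) ε) ≤ b (w, z)) :
    ∫ q, ‖q.1‖ ^ 2 * signFlip q.1 q.2 ∂((isoGaussian p σw).prod
        ((uniformCube (Fin p) 0 1).prod (uniformCube (Fin p) (-ε) ε))) ≤
      ∫ q, ‖q.1‖ ^ 2 * b q ∂((isoGaussian p σw).prod (uniformCube (Fin p) 0 1)) := by
  have h01 := isProbabilityMeasure_uniformCube (ι := Fin p) (zero_lt_one (α := ℝ))
  have hprob := isProbabilityMeasure_uniformCube (ι := Fin p) (show -ε < ε by linarith)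
  -- Reassociation puts the noise innermost, so the conditional bound applies with `‖w‖²` constant.
  have hmp := measurePreserving_prodAssoc (isoGaussian p σw) (uniformCube (Fin p) 0 1)
    (uniformCube (Fin p) (-ε) ε)
  have hint := integrable_norm_sq_mul (σw := σw)
    (κ := (uniformCube (Fin p) 0 1).prod (uniformCube (Fin p) (-ε) ε))
    (f := fun q => signFlip q.1 q.2) measurable_signFlip fun q => abs_signFlip_le_one _ _
  rw [← hmp.integral_comp']
  have hint' := (hmp.integrable_comp_emb (MeasurableEquiv.measurableEmbedding _)).2 hint
  simp only [Function.comp_def] at hint'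
  rw [integral_prod _ hint']
  refine integral_mono_of_nonneg (ae_of_all _ fun q => integral_nonneg fun e =>
    mul_nonneg (sq_nonneg _) (signFlip_nonneg _ _)) (integrable_norm_sq_mul hb hb1)
    (ae_of_all _ fun q => ?_)
  change ∫ e, ‖q.1‖ ^ 2 * signFlip q.1 (q.2, e) ∂(uniformCube (Fin p) (-ε) ε) ≤ ‖q.1‖ ^ 2 * b q
  rw [integral_const_mul]
  gcongr
  exact hle q.1 q.2

/-- The expectation of `‖w‖²` over the event that the noise flips the sign of the pre-activation. -/
noncomputable def flipMass (p : ℕ) (σw ε : ℝ) : ℝ :=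
  ∫ q, ‖q.1‖ ^ 2 * signFlip q.1 q.2 ∂((isoGaussian p σw).prod
    ((uniformCube (Fin p) 0 1).prod (uniformCube (Fin p) (-ε) ε)))

lemma flipMass_le_half (hε : 0 < ε) : flipMass p σw ε ≤ p * σw ^ 2 * (1 / 2) := by
  have h01 := isProbabilityMeasure_uniformCube (ι := Fin p) (zero_lt_one (α := ℝ))
  refine (integral_norm_sq_mul_signFlip_le hε (b := fun _ => 1 / 2) measurable_const
    (fun _ => by norm_num [abs_le]) (integral_signFlip_le_half hε)).trans_eq ?_
  rw [integral_mul_const, integral_norm_sq_fst]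

lemma flipMass_le_sqrt (hp : 2 ≤ p) (hε : 0 < ε) :
    flipMass p σw ε ≤ p * σw ^ 2 * (√2 *
      √(∫ q : EuclideanSpace ℝ (Fin p) × EuclideanSpace ℝ (Fin p),
      Real.exp (-(1 / ε ^ 2) * inner ℝ (‖q.1‖⁻¹ • q.1) q.2 ^ 2)
      ∂((isoGaussian p σw).prod (uniformCube (Fin p) 0 1)))) := by
  have h01 := isProbabilityMeasure_uniformCube (ι := Fin p) (zero_lt_one (α := ℝ))
  set μ := (isoGaussian p σw).prod (uniformCube (Fin p) 0 1)
  set b : EuclideanSpace ℝ (Fin p) × EuclideanSpace ℝ (Fin p) → ℝ :=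
    fun q => Real.exp (-(1 / (2 * ε ^ 2)) * inner ℝ (‖q.1‖⁻¹ • q.1) q.2 ^ 2) with hb
  have hbm : Measurable b :=
    Real.measurable_exp.comp ((((measurable_fst.norm.inv.smul measurable_fst).inner
      measurable_snd).pow_const 2).const_mul _)
  have hb1 : ∀ q, |b q| ≤ 1 := fun q => by
    rw [abs_of_pos (Real.exp_pos _), Real.exp_le_one_iff]
    have : 0 ≤ 1 / (2 * ε ^ 2) := by positivity
    nlinarith [mul_nonneg this (sq_nonneg (inner ℝ (‖q.1‖⁻¹ • q.1) q.2))]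
  -- The square taken in Cauchy–Schwarz turns the Hoeffding exponent `1 / (2 ε²)` into `1 / ε²`.
  have hbsq : ∀ q, b q ^ 2 =
      Real.exp (-(1 / ε ^ 2) * inner ℝ (‖q.1‖⁻¹ • q.1) q.2 ^ 2) := fun q => by
    rw [hb, ← Real.exp_nat_mul]
    congr 1
    push_cast
    field_simp
  have h4 : Integrable (fun q => ‖q.1‖ ^ 4) μ :=
    (integrable_norm_pow_isoGaussian (n := p) (σ := σw) 4).comp_fst (uniformCube (Fin p) 0 1)
  have hmn : Measurable fun q : EuclideanSpace ℝ (Fin p) × EuclideanSpace ℝ (Fin p) => ‖q.1‖ ^ 2 :=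
    by fun_prop
  have hf2 : MemLp (fun q => ‖q.1‖ ^ 2) 2 μ := by
    rw [memLp_two_iff_integrable_sq hmn.aestronglyMeasurable]
    simpa only [← pow_mul] using h4
  have hb2 : MemLp b 2 μ := MemLp.of_bound hbm.aestronglyMeasurable 1 (ae_of_all _ hb1)
  have hcs := integral_mul_le_Lp_mul_Lq_of_nonneg (μ := μ) Real.HolderConjugate.two_two
    (f := fun q => ‖q.1‖ ^ 2) (g := b) (ae_of_all _ fun q => sq_nonneg _)
    (ae_of_all _ fun q => (Real.exp_pos _).le) (by simpa using hf2) (by simpa using hb2)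
  simp only [Real.rpow_two, ← Real.sqrt_eq_rpow, hbsq, ← pow_mul, Nat.reduceMul] at hcs
  have h4val : ∫ q, ‖q.1‖ ^ 4 ∂μ = p * (p + 2) * σw ^ 4 := by
    rw [integral_fun_fst (f := fun w : EuclideanSpace ℝ (Fin p) => ‖w‖ ^ 4)]
    simp [integral_norm_pow_four_isoGaussian]
  have hsqrt : √(∫ q, ‖q.1‖ ^ 4 ∂μ) ≤ p * σw ^ 2 * √2 := by
    have hp' : (2 : ℝ) ≤ p := by exact_mod_cast hp
    refine Real.sqrt_le_iff.2 ⟨by positivity, ?_⟩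
    rw [h4val, mul_pow, Real.sq_sqrt (by norm_num)]
    -- `p (p + 2) ≤ 2 p²` is exactly the condition `p ≥ 2`, and it is the source of the factor `√2`.
    have : 0 ≤ (p : ℝ) * σw ^ 4 * (p - 2) := by
      have := sub_nonneg.2 hp'
      positivity
    nlinarith
  refine (integral_norm_sq_mul_signFlip_le hε hbm hb1 (integral_signFlip_le_exp hε)).trans
    (hcs.trans ?_)
  rw [← mul_assoc]
  gcongr

/-- By the symmetry of `w` half of `E‖w‖²` survives the gate, whatever the law of the patch. Clean
and noisy gates thus share one limit, and the square roots in the cosine combine. -/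
lemma integral_gate_mul_self {Ξ : Type*} [MeasurableSpace Ξ] {κ : Measure Ξ}
    [IsProbabilityMeasure κ] {f : Ξ → EuclideanSpace ℝ (Fin p)} (hf : Measurable f)
    (hne : ∀ᵐ q ∂((isoGaussian p σw).prod κ), inner ℝ q.1 (f q.2) ≠ 0) :
    ∫ w, σu ^ 2 * ‖w‖ ^ 2 * ∫ ξ, gate w (f ξ) * gate w (f ξ) ∂κ ∂(isoGaussian p σw) =
      σu ^ 2 * (p * σw ^ 2 / 2) := by
  have hm : Measurable (Function.uncurry fun w ξ => gate w (f ξ) * gate w (f ξ)) :=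
    (measurable_gate_comp hf).mul (measurable_gate_comp hf)
  have h1 : ∀ w ξ, |gate w (f ξ) * gate w (f ξ)| ≤ 1 := fun w ξ => by
    rw [abs_mul]
    exact mul_le_one₀ (abs_gate_le_one _ _) (abs_nonneg _) (abs_gate_le_one _ _)
  rw [integral_integral_norm_sq_mul hm h1]
  have h := two_mul_integral_norm_sq_mul (σw := σw) (κ := κ)
    (f := fun q => gate q.1 (f q.2) * gate q.1 (f q.2)) (g := fun _ => 1) hm (fun q => h1 _ _)
    (hne.mono fun q hq => gate_mul_self_add_neg hq)
  simp only [mul_one, integral_norm_sq_fst] at h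
  rw [← h]
  ring

lemma integral_cleanGate_mul_noisyGate (hp : 2 ≤ p) (hσw : 0 < σw) (hε : 0 < ε) :
    ∫ w, σu ^ 2 * ‖w‖ ^ 2 * ∫ ξ, cleanGate w ξ * noisyGate w ξ
      ∂((uniformCube (Fin p) 0 1).prod (uniformCube (Fin p) (-ε) ε)) ∂(isoGaussian p σw) =
      σu ^ 2 * ((p * σw ^ 2 - flipMass p σw ε) / 2) := by
  have h01 := isProbabilityMeasure_uniformCube (ι := Fin p) (zero_lt_one (α := ℝ))
  have hprob := isProbabilityMeasure_uniformCube (ι := Fin p) (show -ε < ε by linarith)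
  have hm : Measurable (Function.uncurry fun w ξ => cleanGate (p := p) w ξ * noisyGate w ξ) :=
    measurable_cleanGate.mul measurable_noisyGate
  have h1 : ∀ w ξ, |cleanGate (p := p) w ξ * noisyGate w ξ| ≤ 1 := fun w ξ => by
    rw [abs_mul]
    exact mul_le_one₀ (abs_gate_le_one _ _) (abs_nonneg _) (abs_gate_le_one _ _)
  rw [integral_integral_norm_sq_mul hm h1]
  have h := two_mul_integral_norm_sq_mul (σw := σw)
    (κ := (uniformCube (Fin p) 0 1).prod (uniformCube (Fin p) (-ε) ε))
    (f := fun q => cleanGate q.1 q.2 * noisyGate q.1 q.2)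
    (g := fun q => 1 - signFlip q.1 q.2) hm (fun q => h1 _ _)
    (by
      filter_upwards [ae_inner_ne_zero hp hσw hε] with q hq
      exact gate_mul_gate_add_neg hq.1 hq.2)
  have hflip := integrable_norm_sq_mul (σw := σw)
    (κ := (uniformCube (Fin p) 0 1).prod (uniformCube (Fin p) (-ε) ε))
    (f := fun q => signFlip q.1 q.2) measurable_signFlip fun q => abs_signFlip_le_one _ _
  have hnorm := (integrable_norm_pow_isoGaussian (n := p) (σ := σw) 2).comp_fst
    ((uniformCube (Fin p) 0 1).prod (uniformCube (Fin p) (-ε) ε))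
  simp only [mul_sub, mul_one] at h
  rw [integral_sub hnorm hflip, integral_norm_sq_fst] at h
  rw [flipMass, ← h]
  ring

/-- Each normalized inner product of gated sums converges in probability under the joint law. -/
lemma tendsto_law_averageInner (hε : 0 < ε)
    {A B : EuclideanSpace ℝ (Fin p) → EuclideanSpace ℝ (Fin p) × EuclideanSpace ℝ (Fin p) → ℝ}
    (hA : Measurable (Function.uncurry A)) (hB : Measurable (Function.uncurry B))
    (hA1 : ∀ w ξ, |A w ξ| ≤ 1) (hB1 : ∀ w ξ, |B w ξ| ≤ 1) {t : ℝ}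
    (ht : ∫ w, σu ^ 2 * ‖w‖ ^ 2 * ∫ ξ, A w ξ * B w ξ
      ∂((uniformCube (Fin p) 0 1).prod (uniformCube (Fin p) (-ε) ε)) ∂(isoGaussian p σw) = t)
    {δ : ℝ} (hδ : 0 < δ) :
    Tendsto (fun n : ℕ × ℕ => law p n.1 n.2 σw σu ε
      {s | δ ≤ |averageInner A B (regroup s) - t|}) (atTop ×ˢ atTop) (𝓝 0) := by
  have h01 := isProbabilityMeasure_uniformCube (ι := Fin p) (zero_lt_one (α := ℝ))
  have hprob := isProbabilityMeasure_uniformCube (ι := Fin p) (show -ε < ε by linarith)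
  have h := tendsto_measure_average_inner_gatedSum (σ := σu)
    (κ := (uniformCube (Fin p) 0 1).prod (uniformCube (Fin p) (-ε) ε))
    (integrable_norm_pow_isoGaussian (n := p) (σ := σw) 4) hA hB hA1 hB1 hδ
  rw [ht] at h
  refine tendsto_of_tendsto_of_tendsto_of_le_of_le tendsto_const_nhds h (fun _ => zero_le)
    fun n => ?_
  exact (measurePreserving_regroup (p := p) (k := n.1) (m := n.2) (σw := σw) (σu := σu)
    hε).measure_preimage_le _

end Limit

end GradAlign

/-! ### Convergence of the cosine by continuous mapping, and the lower bound. -/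

theorem lemma2 (p : ℕ) (hp : 2 ≤ p) (σw σu ε : ℝ) (hσw : 0 < σw) (hσu : 0 < σu) (hε : 0 < ε)
    {Y : Type*} (loss : ℝ → Y → ℝ)
    (hdiff : ∀ y, Differentiable ℝ fun t => loss t y)
    (hsign : ∀ y, (∀ t, 0 < deriv (fun t' => loss t' y) t) ∨
      (∀ t, deriv (fun t' => loss t' y) t < 0))
    (c : ∀ k m : ℕ, GradAlign.Sample p k m → ℝ)
    (y : ∀ k m : ℕ, GradAlign.Sample p k m → Y) :
    ∃ L : ℝ,
      (∀ δ : ℝ, 0 < δ →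
        Tendsto
          (fun n : ℕ × ℕ => GradAlign.law p n.1 n.2 σw σu ε
            {s | δ ≤ |GradAlign.alignment loss (c n.1 n.2 s) (y n.1 n.2 s) s - L|})
          (atTop ×ˢ atTop) (𝓝 0)) ∧
      max
          (1 - √2 * √(∫ q : EuclideanSpace ℝ (Fin p) × EuclideanSpace ℝ (Fin p),
            Real.exp (-(1 / ε ^ 2) * inner ℝ (‖q.1‖⁻¹ • q.1) q.2 ^ 2)
            ∂((GradAlign.isoGaussian p σw).prod (GradAlign.uniformCube (Fin p) 0 1))))
          (1 / 2)
        ≤ L := by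
  have hp0 : (0 : ℝ) < p := by exact_mod_cast (by omega : 0 < p)
  have hS : 0 < p * σw ^ 2 := by positivity
  refine ⟨1 - GradAlign.flipMass p σw ε / (p * σw ^ 2), fun δ hδ => ?_, max_le ?_ ?_⟩
  · set τ₁ := σu ^ 2 * ((p * σw ^ 2 - GradAlign.flipMass p σw ε) / 2) with hτ₁
    set τ₂ := σu ^ 2 * (p * σw ^ 2 / 2) with hτ₂
    have hτ₂pos : 0 < τ₂ := by positivity
    have hL : τ₁ / (√τ₂ * √τ₂) = 1 - GradAlign.flipMass p σw ε / (p * σw ^ 2) := by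
      rw [Real.mul_self_sqrt hτ₂pos.le, hτ₁, hτ₂]
      field_simp
    have hcont : ContinuousAt (fun v : ℝ × ℝ × ℝ => v.1 / (√v.2.1 * √v.2.2)) (τ₁, τ₂, τ₂) := by
      have : √τ₂ * √τ₂ ≠ 0 := by rw [Real.mul_self_sqrt hτ₂pos.le]; exact hτ₂pos.ne'
      fun_prop (disch := assumption)
    obtain ⟨r, hr, hball⟩ := Metric.continuousAt_iff.1 hcont δ hδ
    have h01 := GradAlign.isProbabilityMeasure_uniformCube (ι := Fin p) (zero_lt_one (α := ℝ))
    have hprob := GradAlign.isProbabilityMeasure_uniformCube (ι := Fin p)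
      (show -ε < ε by linarith)
    have hne := GradAlign.ae_inner_ne_zero hp hσw hε
    have t1 := GradAlign.tendsto_law_averageInner (σu := σu) hε GradAlign.measurable_cleanGate
      GradAlign.measurable_noisyGate GradAlign.abs_cleanGate_le_one GradAlign.abs_noisyGate_le_one
      (GradAlign.integral_cleanGate_mul_noisyGate hp hσw hε) hr
    have t2 := GradAlign.tendsto_law_averageInner (σu := σu) hε GradAlign.measurable_cleanGate
      GradAlign.measurable_cleanGate GradAlign.abs_cleanGate_le_one GradAlign.abs_cleanGate_le_one
      (GradAlign.integral_gate_mul_self measurable_fst (hne.mono fun _ h => h.1)) hr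
    have t3 := GradAlign.tendsto_law_averageInner (σu := σu) hε GradAlign.measurable_noisyGate
      GradAlign.measurable_noisyGate GradAlign.abs_noisyGate_le_one GradAlign.abs_noisyGate_le_one
      (GradAlign.integral_gate_mul_self (measurable_fst.add measurable_snd)
        (hne.mono fun _ h => h.2)) hr
    have hsum := t1.add (t2.add t3)
    simp only [add_zero] at hsum
    refine tendsto_of_tendsto_of_tendsto_of_le_of_le' tendsto_const_nhds hsum
      (Eventually.of_forall fun _ => zero_le) ?_
    filter_upwards [prod_mem_prod (eventually_gt_atTop 0) (eventually_gt_atTop 0)] with n hn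
    -- Off a null set, a deviation of the cosine by `δ` forces one of the three averages to deviate
    -- by `r`. Only monotonicity and subadditivity are used, so the bad set need not be measurable,
    -- and `c` and `y` may be arbitrary functions of the sample.
    refine le_trans (measure_mono_ae ?_) ((measure_union_le _ _).trans
      (add_le_add le_rfl (measure_union_le _ _)))
    filter_upwards [GradAlign.ae_law_inner_ne_zero (k := n.1) (m := n.2) (σu := σu) hp hσw hε]
      with s hs hbad
    have hbad' : δ ≤ |GradAlign.alignment loss (c n.1 n.2 s) (y n.1 n.2 s) s -
      (1 - GradAlign.flipMass p σw ε / (p * σw ^ 2))| := hbad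
    by_contra hgood
    rw [GradAlign.alignment_eq _ (hdiff _) (hsign _) hn.1 hn.2 hs, ← hL] at hbad'
    have hgood' : ¬ (r ≤ |GradAlign.averageInner GradAlign.cleanGate GradAlign.noisyGate
          (GradAlign.regroup s) - τ₁| ∨
        r ≤ |GradAlign.averageInner GradAlign.cleanGate GradAlign.cleanGate
          (GradAlign.regroup s) - τ₂| ∨
        r ≤ |GradAlign.averageInner GradAlign.noisyGate GradAlign.noisyGate
          (GradAlign.regroup s) - τ₂|) := hgood
    push Not at hgood'
    have hlt := hball (x := (_, _, _)) (by
      simp only [Prod.dist_eq, Real.dist_eq, sup_lt_iff]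
      exact hgood')
    rw [Real.dist_eq] at hlt
    exact absurd hlt hbad'.not_gt
  · have h := GradAlign.flipMass_le_sqrt (σw := σw) hp hε
    have := (div_le_iff₀' hS).2 h
    linarith
  · have h := GradAlign.flipMass_le_half (p := p) (σw := σw) hε
    have := (div_le_iff₀' hS).2 h
    linarith
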